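/- Let $q$ be a prime power, let $m,n,r$ be positive integers such that $m$ divides $rn$, and write $[i]=q^i$. View $\mathbb{F}_{q^m}$ and $\mathbb{F}_{q^r}$ as subfields of $\mathbb{F}_{q^{rn}}$. \emph{Codes.} Let $C\subseteq\mathbb{F}_{q^m}^n$ be an $\mathbb{F}_{q^m}$-linear $q^r$-cyclic code, i.e. $(c_{n-1}^{[r]},c_0^{[r]},\ldots,c_{n-2}^{[r]})\in C$ for all $(c_0,c_1,\ldots,c_{n-1})\in C$. The rank weight of a vector over $\mathbb{F}_{q^m}$ is the dimension of the $\mathbb{F}_q$-linear span of its components. A linear space $V\subseteq\mathbb{F}_{q^m}^n$ is Galois closed if it is stable under raising all components to the power $q$. Linear codes $C\subseteq\mathbb{F}_{q^m}^n$ and $C'\subseteq\mathbb{F}_{q^m}^{n'}$ are rank equivalent if there are linear Galois closed spaces $V\supseteq C$, $V'\supseteq C'$ and an $\mathbb{F}_{q^m}$-linear isomorphism $\phi:V\to V'$ that preserves rank weights and satisfies $\phi(C)=C'$. The rank length $l_R(C)$ is the minimum $n'\ge 0$ such that $C$ is rank equivalent to a linear code of length $n'$. \emph{Linearized polynomials.}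 Let $\mathcal{L}$ be the ring of polynomials $F(x)=F_0x+F_1x^{[r]}+\cdots+F_dx^{[dr]}$ with $F_i\in\mathbb{F}_{q^m}$, with composition $\otimes$ as product; put $\deg_{q^r}F=d$ if $F_d\neq 0$. Divisibility is on the right ($A$ divides $B$ if $B=Q\otimes A$ for some $Q\in\mathcal{L}$), and $\gcd$ and $\mathrm{lcm}$ are the monic ones for this divisibility. Let $\theta_i$ act on $\mathcal{L}$ by raising every coefficient to the power $[i]$. Identify $(c_0,\ldots,c_{n-1})\in\mathbb{F}_{q^m}^n$ with the residue class of $c_0x+c_1x^{[r]}+\cdots+c_{n-1}x^{[(n-1)r]}$ modulo the two-sided ideal of $\mathcal{L}$ generated by $x^{[rn]}-x$. Let $G$ be the generator polynomial of $C$, i.e. the monic polynomial of minimal $q^r$-degree among the nonzero elements of $\mathcal{L}$ with residue class in $C$, and let $H\in\mathcal{L}$ be its check polynomial, i.e. $G\otimes H=H\otimes G=x^{[rn]}-x$. Write $H=H_0x+H_1x^{[r]}+\cdots+H_kx^{[kr]}$ with $H_k\ne0$, and put $$H^\perp(x)=\sum_{i=0}^{k}\frac{H_{k-i}^{[ir]}}{H_0^{[kr]}}\,x^{[ir]}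 .$$ For $F\in\mathcal{L}$ let $Z(F)$ be the $\mathbb{F}_{q^r}$-linear space of zeroes of $F$ in $\mathbb{F}_{q^{rn}}$, and for a subspace $W$ let $W^{[i]}=\{w^{[i]} : w\in W\}$. Then the following $\gcd$ and $\mathrm{lcm}$ exist and are unique, and $$l_R(C)=n-\deg_{q^r}\bigl(\gcd(G,\theta_1(G),\ldots,\theta_{m-1}(G))\bigr)=\deg_{q^r}\bigl(\mathrm{lcm}(H^\perp,\theta_1(H^\perp),\ldots,\theta_{m-1}(H^\perp))\bigr)$$ $$=n-\dim_{\mathbb{F}_{q^r}}\Bigl(\bigcap_{i=0}^{m-1}Z(G)^{[i]}\Bigr)=\dim_{\mathbb{F}_{q^r}}\Bigl(\sum_{i=0}^{m-1}Z(H^\perp)^{[i]}\Bigr).$$ -/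

import Mathlib

open Polynomial

namespace SkewCyclic

section Codes

/-- The rank weight of a vector: the `Fq`-dimension of the `Fq`-span of its components. -/
noncomputable def rankWeight (Fq : Type*) {K : Type*} [Field Fq] [Field K] [Algebra Fq K]
    {n : ℕ} (c : Fin n → K) : ℕ :=
  Module.finrank Fq (Submodule.span Fq (Set.range c))

/-- The operator `s_n (c_0, …, c_{n-1}) = (c_{n-1}, c_0, …, c_{n-2})`. -/
def shift {K : Type*} {n : ℕ} (c : Fin n → K) : Fin n → K :=
  fun i => c ((finRotate n).symm i)

/-- The `i`-th Frobenius operator `θ_i`, raising every component to the power `q ^ i`. -/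
def frobVec {K : Type*} [Field K] (q i : ℕ) {n : ℕ} (c : Fin n → K) : Fin n → K :=
  fun j => c j ^ q ^ i

/-- A linear code is `q^r`-cyclic if it is stable under `σ_{r,n} = θ_r ∘ s_n`. -/
def IsSkewCyclic {K : Type*} [Field K] (q r : ℕ) {n : ℕ} (C : Submodule K (Fin n → K)) : Prop :=
  ∀ c ∈ C, frobVec q r (shift c) ∈ C

/-- A linear code is Galois closed over the field with `q` elements if it is stable
under `θ_1`. -/
def IsGaloisClosed {K : Type*} [Field K] (q : ℕ) {n : ℕ} (V : Submodule K (Fin n → K)) : Prop :=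
  ∀ c ∈ V, frobVec q 1 c ∈ V

/-- Two linear codes are rank equivalent if a rank-weight-preserving vector space isomorphism
between linear Galois closed spaces containing them maps the first code onto the second. -/
def RankEquivalent (Fq : Type*) {K : Type*} [Field Fq] [Fintype Fq] [Field K] [Algebra Fq K]
    {n n' : ℕ} (C : Submodule K (Fin n → K)) (C' : Submodule K (Fin n' → K)) : Prop :=
  ∃ (V : Submodule K (Fin n → K)) (V' : Submodule K (Fin n' → K)),
    IsGaloisClosed (Fintype.card Fq) V ∧ IsGaloisClosed (Fintype.card Fq) V' ∧
    C ≤ V ∧ C' ≤ V' ∧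
    ∃ φ : V ≃ₗ[K] V',
      (∀ c : V, rankWeight Fq (φ c : Fin n' → K) = rankWeight Fq (c : Fin n → K)) ∧
      ∀ c : V, (φ c : Fin n' → K) ∈ C' ↔ (c : Fin n → K) ∈ C

/-- The rank length: the minimum `n'` such that the code is rank equivalent to a linear code
of length `n'`. -/
noncomputable def rankLength (Fq : Type*) {K : Type*} [Field Fq] [Fintype Fq] [Field K]
    [Algebra Fq K] {n : ℕ} (C : Submodule K (Fin n → K)) : ℕ :=
  sInf {n' : ℕ | ∃ C' : Submodule K (Fin n' → K), RankEquivalent Fq C C'}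

/-- The set whose minimum is the rank length contains the length of the code. -/
theorem rankLength_set_nonempty (Fq : Type*) {K : Type*} [Field Fq] [Fintype Fq] [Field K]
    [Algebra Fq K] {n : ℕ} (C : Submodule K (Fin n → K)) :
    n ∈ {n' : ℕ | ∃ C' : Submodule K (Fin n' → K), RankEquivalent Fq C C'} :=
  ⟨C, ⊤, ⊤, fun _ _ => trivial, fun _ _ => trivial, le_top, le_top,
    LinearEquiv.refl K _, fun _ => rfl, fun _ => Iff.rfl⟩

end Codes

section Linearized

variable {K : Type*} [Field K]

/-- `F` is a `q^r`-linearized polynomial `F_0 x + F_1 x^{[r]} + ⋯ + F_d x^{[dr]}`, where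
`[j] = q ^ j`; its coefficient `F_i` is `F.coeff (q ^ (r * i))`. The product of two such
polynomials is their composition `Polynomial.comp`. -/
def IsLinearized (q r : ℕ) (F : K[X]) : Prop :=
  ∀ j, F.coeff j ≠ 0 → ∃ i, j = q ^ (r * i)

/-- The `q^r`-degree: the largest `d` with `F_d ≠ 0`. -/
noncomputable def qDeg (q r : ℕ) (F : K[X]) : ℕ :=
  sSup {d : ℕ | F.coeff (q ^ (r * d)) ≠ 0}

/-- `A` divides `B` on the right in the ring of `q^r`-linearized polynomials. -/
def RightDvd (q r : ℕ) (A B : K[X]) : Prop :=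
  ∃ Q : K[X], IsLinearized q r Q ∧ B = Q.comp A

/-- `D` is the (monic) greatest common divisor on the right of the family `F`. -/
structure IsRightGcd (q r : ℕ) {ι : Type*} (F : ι → K[X]) (D : K[X]) : Prop where
  isLinearized : IsLinearized q r D
  monic : D.Monic
  dvd : ∀ i, RightDvd q r D (F i)
  greatest : ∀ D', IsLinearized q r D' → (∀ i, RightDvd q r D' (F i)) → RightDvd q r D' D

/-- `M` is the (monic) least common multiple of the family `F`, for divisibility on the right. -/
structure IsRightLcm (q r : ℕ) {ι : Type*} (F : ι → K[X]) (M : K[X]) : Prop where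
  isLinearized : IsLinearized q r M
  monic : M.Monic
  dvd : ∀ i, RightDvd q r (F i) M
  least : ∀ M', IsLinearized q r M' → (∀ i, RightDvd q r (F i) M') → RightDvd q r M M'

/-- The automorphism `θ_i`, raising every coefficient to the power `q ^ i`. -/
noncomputable def frobPoly (q i : ℕ) (F : K[X]) : K[X] :=
  F.sum fun j a => Polynomial.C (a ^ q ^ i) * X ^ j

/-- `F^⊥ = ∑_{i=0}^{d} (F_{d-i}^{[ir]} / F_0^{[dr]}) x^{[ir]}`, where `d` is the `q^r`-degree
of `F`. -/
noncomputable def perp (q r : ℕ) (F : K[X]) : K[X] :=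
  ∑ i ∈ Finset.range (qDeg q r F + 1),
    Polynomial.C (F.coeff (q ^ (r * (qDeg q r F - i))) ^ q ^ (i * r) /
      F.coeff (q ^ (r * 0)) ^ q ^ (qDeg q r F * r)) * X ^ q ^ (r * i)

/-- The polynomial `x^{[rn]} - x`. -/
noncomputable def modulus (K : Type*) [Field K] (q r n : ℕ) : K[X] :=
  X ^ q ^ (r * n) - X

/-- The polynomial `c_0 x + c_1 x^{[r]} + ⋯ + c_{n-1} x^{[(n-1)r]}` attached to a vector. -/
noncomputable def vecPoly (q r : ℕ) {n : ℕ} (c : Fin n → K) : K[X] :=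
  ∑ j : Fin n, Polynomial.C (c j) * X ^ q ^ (r * (j : ℕ))

/-- `F` is a `q^r`-linearized polynomial whose residue class modulo the left ideal generated by
`x^{[rn]} - x` is the class of a codeword of `C`. -/
def MemCode (q r : ℕ) {n : ℕ} (C : Submodule K (Fin n → K)) (F : K[X]) : Prop :=
  ∃ c ∈ C, ∃ A : K[X], IsLinearized q r A ∧ F = vecPoly q r c + A.comp (modulus K q r n)

/-- `G` is the generator polynomial of `C`: monic and of minimal `q^r`-degree among the nonzero
polynomials with residue class in `C`. -/
structure IsGeneratorPoly (q r : ℕ) {n : ℕ} (C : Submodule K (Fin n → K)) (G : K[X]) : Prop where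
  isLinearized : IsLinearized q r G
  monic : G.Monic
  mem : MemCode q r C G
  minimal : ∀ F : K[X], F ≠ 0 → MemCode q r C F → qDeg q r G ≤ qDeg q r F

/-- `H` is the check polynomial attached to the generator polynomial `G` of a code of
length `n`. -/
structure IsCheckPoly (q r n : ℕ) (G H : K[X]) : Prop where
  isLinearized : IsLinearized q r H
  gen_comp_check : G.comp H = modulus K q r n
  check_comp_gen : H.comp G = modulus K q r n

end Linearized

section RootSpaces

/-- The `E`-linear space `Z(F)` of zeroes of `F` in `L`. When `F` is `q^r`-linearized and `E` has
`q^r` elements the set of zeroes is itself a subspace, see `mem_rootSpace`. -/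
noncomputable def rootSpace (E L : Type*) {K : Type*} [Field E] [Field K] [Field L] [Algebra K L]
    [Algebra E L] (F : K[X]) : Submodule E L :=
  Submodule.span E {z : L | aeval z F = 0}

/-- The `E`-linear space `W^{[i]}` of the powers `w ^ (q ^ i)`, `w ∈ W`. When `q` is the
cardinality of a common subfield of the finite fields `E` and `L`, the set of these powers is
itself a subspace, see `mem_powSpace`. -/
noncomputable def powSpace {E L : Type*} [Field E] [Field L] [Algebra E L] (q i : ℕ)
    (W : Submodule E L) : Submodule E L :=
  Submodule.span E ((fun w : L => w ^ q ^ i) '' (W : Set L))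

theorem mem_rootSpace {E L K : Type*} [Field E] [Fintype E] [Field K] [Field L]
    [Algebra K L] [Algebra E L] {q r : ℕ} (hE : Fintype.card E = q ^ r) {F : K[X]}
    (hF : IsLinearized q r F) (z : L) : z ∈ rootSpace E L F ↔ aeval z F = 0 := by
  have key : ∀ (j : ℕ), F.coeff j ≠ 0 → ∃ φ : L →ₗ[E] L, ∀ z, φ z = z ^ j := by
    intro j hj
    obtain ⟨i, rfl⟩ := hF j hj
    refine ⟨((FiniteField.frobeniusAlgHom E L) ^ i).toLinearMap, fun z => ?_⟩
    rw [pow_mul, ← hE]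
    simp only [AlgHom.toLinearMap_apply, AlgHom.coe_pow]
    simp [FiniteField.coe_frobeniusAlgHom, pow_iterate]
  have hev : ∀ z : L, aeval z F = ∑ j ∈ F.support, algebraMap K L (F.coeff j) * z ^ j := by
    intro z
    rw [aeval_def, eval₂_eq_sum, Polynomial.sum]
  constructor
  · intro hz
    refine Submodule.span_induction (p := fun z _ => aeval z F = 0) (fun _ h => h) ?_ ?_ ?_ hz
    · rw [hev]
      refine Finset.sum_eq_zero fun j hj => ?_
      obtain ⟨φ, hφ⟩ := key j (mem_support_iff.1 hj)
      rw [← hφ, map_zero, mul_zero]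
    · intro x y _ _ hx hy
      rw [hev] at hx hy ⊢
      rw [← add_zero (0 : L), ← hx]
      nth_rewrite 2 [hx]
      rw [← hy, ← Finset.sum_add_distrib]
      refine Finset.sum_congr rfl fun j hj => ?_
      obtain ⟨φ, hφ⟩ := key j (mem_support_iff.1 hj)
      rw [← hφ, ← hφ, ← hφ, map_add, mul_add]
    · intro a x _ hx
      rw [hev] at hx ⊢
      rw [← smul_zero a, ← hx, Finset.smul_sum]
      refine Finset.sum_congr rfl fun j hj => ?_
      obtain ⟨φ, hφ⟩ := key j (mem_support_iff.1 hj)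
      rw [← hφ, ← hφ, map_smul, mul_smul_comm]
  · exact fun h => Submodule.subset_span h

theorem mem_powSpace {Fq E L : Type*} [Field Fq] [Fintype Fq] [Field E] [Finite E] [Field L]
    [Algebra Fq E] [Algebra Fq L] [Algebra E L] [IsScalarTower Fq E L] (i : ℕ)
    (W : Submodule E L) (z : L) :
    z ∈ powSpace (Fintype.card Fq) i W ↔ ∃ w ∈ W, w ^ Fintype.card Fq ^ i = z := by
  have hfrob : ∀ (A : Type _) [Field A] [Algebra Fq A] (x : A),
      ((FiniteField.frobeniusAlgHom Fq A) ^ i) x = x ^ Fintype.card Fq ^ i := by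
    intro A _ _ x
    simp only [AlgHom.coe_pow]
    simp [FiniteField.coe_frobeniusAlgHom, pow_iterate]
  have hfrobE : ∀ (x : E),
      ((FiniteField.frobeniusAlgHom Fq E) ^ i) x = x ^ Fintype.card Fq ^ i := by
    intro x
    simp only [AlgHom.coe_pow]
    simp [FiniteField.coe_frobeniusAlgHom, pow_iterate]
  constructor
  · intro hz
    refine Submodule.span_induction
      (p := fun z _ => ∃ w ∈ W, w ^ Fintype.card Fq ^ i = z) (fun _ h => h) ?_ ?_ ?_ hz
    · exact ⟨0, W.zero_mem, by rw [← hfrob, map_zero]⟩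
    · rintro _ _ _ _ ⟨x, hx, rfl⟩ ⟨y, hy, rfl⟩
      exact ⟨x + y, W.add_mem hx hy, by rw [← hfrob, ← hfrob, ← hfrob, map_add]⟩
    · rintro a _ _ ⟨x, hx, rfl⟩
      have hs : Function.Surjective ((FiniteField.frobeniusAlgHom Fq E) ^ i) :=
        Finite.surjective_of_injective (RingHom.injective
          ((FiniteField.frobeniusAlgHom Fq E) ^ i).toRingHom)
      obtain ⟨b, rfl⟩ := hs a
      refine ⟨b • x, W.smul_mem b hx, ?_⟩
      rw [hfrobE, Algebra.smul_def, Algebra.smul_def, mul_pow, map_pow]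
  · rintro ⟨w, hw, rfl⟩
    exact Submodule.subset_span ⟨w, hw, rfl⟩

end RootSpaces

end SkewCyclic

/-! The rank length is computed in three moves: it is the dimension of the smallest Galois closed
space containing `C`, that space is the cyclic code generated by the gcd of the conjugates of `G`,
and the remaining formulas follow by passing to zeroes in `L` and dualizing with the trace form of
`L/E`.

A Galois closed space has a basis over `Fq`. Coordinates in that basis, and their inverse, are given
by matrices over `Fq`, so they preserve rank weights. Hence a Galois closed space `V` containing `C`
realizes `C` in length `dim V`. Conversely, an equivalence with a code of length `n'` embeds such a
`V` into `K^{n'}` (`rankLength_eq_finrank`).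

Under `c ↦ vecPoly c`, the skew cyclic shift is left multiplication by `x^{[r]}` modulo `x^{[rn]} -
x`, so cyclic codes are left ideals, and these are principal by right division. For linearized
polynomials, right divisibility is ordinary divisibility in `K[X]` (`rightDvd_iff_dvd`). The gcd `D`
of the conjugates of `G` is fixed by `θ_1`, because `θ_m` is the identity and the conjugates are
permuted. So the multiples of `D` form a Galois closed code of dimension `n - deg D`, and it is the
smallest one containing `C` (`rankLength_eq_sub_qDeg_gcd`).

Since `|L| = q^{rn}`, a divisor of `x^{[rn]} - x` has a zero space of dimension equal to its
`q^r`-degree. The zero space of `D` is the intersection of those of the conjugates of `G`, and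
conjugating a polynomial raises its zeroes to the power `[i]`. Moreover `Z(H^⊥)` is the
trace-orthogonal of `Z(G)` (`rootSpace_perp`). Orthogonality turns intersections into sums, so if
`HD` is the check polynomial of `D`, then `HD^⊥` has zero space `∑ Z(θ_i(H^⊥))`. It is therefore the
required lcm, of degree `n - deg D`. -/

namespace SkewCyclic


/-! ### Additivity of the powers `q^i`. -/

section Frobenius

/-- The `i`-th power of the Frobenius endomorphism of an algebra over a finite field. -/
noncomputable def powHom (Fq R : Type*) [Field Fq] [Fintype Fq] [CommRing R] [Algebra Fq R]
    (i : ℕ) : R →ₐ[Fq] R :=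
  (FiniteField.frobeniusAlgHom Fq R) ^ i

variable {Fq R : Type*} [Field Fq] [Fintype Fq] [CommRing R] [Algebra Fq R]

theorem powHom_apply (i : ℕ) (x : R) : powHom Fq R i x = x ^ Fintype.card Fq ^ i := by
  simp only [powHom, AlgHom.coe_pow]
  simp [FiniteField.coe_frobeniusAlgHom, pow_iterate]

theorem add_pow_card_pow (i : ℕ) (x y : R) :
    (x + y) ^ Fintype.card Fq ^ i = x ^ Fintype.card Fq ^ i + y ^ Fintype.card Fq ^ i := by
  simp only [← powHom_apply, map_add]

theorem sub_pow_card_pow (i : ℕ) (x y : R) :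
    (x - y) ^ Fintype.card Fq ^ i = x ^ Fintype.card Fq ^ i - y ^ Fintype.card Fq ^ i := by
  simp only [← powHom_apply, map_sub]

theorem sum_pow_card_pow {ι : Type*} (s : Finset ι) (i : ℕ) (f : ι → R) :
    (∑ j ∈ s, f j) ^ Fintype.card Fq ^ i = ∑ j ∈ s, f j ^ Fintype.card Fq ^ i := by
  simp only [← powHom_apply, map_sum]

end Frobenius

/-! ### Linearized polynomials and their degrees. -/

section Linearized

variable {K : Type*} [Field K] {q r : ℕ}

theorem isLinearized_zero : IsLinearized q r (0 : K[X]) := fun j h => by simp at h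

theorem IsLinearized.add {A B : K[X]} (hA : IsLinearized q r A) (hB : IsLinearized q r B) :
    IsLinearized q r (A + B) := by
  intro j hj
  by_cases h : A.coeff j = 0
  · exact hB j (by simpa [h] using hj)
  · exact hA j h

theorem IsLinearized.C_mul {A : K[X]} (hA : IsLinearized q r A) (a : K) :
    IsLinearized q r (C a * A) := by
  intro j hj
  rw [coeff_C_mul] at hj
  exact hA j (right_ne_zero_of_mul hj)

theorem IsLinearized.sub {A B : K[X]} (hA : IsLinearized q r A) (hB : IsLinearized q r B) :
    IsLinearized q r (A - B) := by
  have := hA.add (hB.C_mul (-1))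
  simpa [sub_eq_add_neg] using this

theorem isLinearized_X_pow (i : ℕ) : IsLinearized q r (X ^ q ^ (r * i) : K[X]) := by
  intro j hj
  rw [coeff_X_pow] at hj
  exact ⟨i, by_contra fun h => hj (if_neg h)⟩

theorem isLinearized_X : IsLinearized q r (X : K[X]) := by
  simpa using isLinearized_X_pow (K := K) (q := q) (r := r) 0

theorem isLinearized_monomial (a : K) (i : ℕ) :
    IsLinearized q r (C a * X ^ q ^ (r * i) : K[X]) :=
  (isLinearized_X_pow i).C_mul a

theorem IsLinearized.sum {ι : Type*} {s : Finset ι} {f : ι → K[X]}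
    (h : ∀ i ∈ s, IsLinearized q r (f i)) : IsLinearized q r (∑ i ∈ s, f i) :=
  Finset.sum_induction f (IsLinearized q r) (fun _ _ => IsLinearized.add) isLinearized_zero h

theorem IsLinearized.induction {P : K[X] → Prop} (zero : P 0)
    (hadd : ∀ A B, P A → P B → P (A + B)) (monomial : ∀ a i, P (C a * X ^ q ^ (r * i)))
    {F : K[X]} (hF : IsLinearized q r F) : P F := by
  rw [F.as_sum_support_C_mul_X_pow]
  refine Finset.sum_induction _ P hadd zero fun j hj => ?_
  obtain ⟨i, rfl⟩ := hF j (mem_support_iff.1 hj)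
  exact monomial _ i

theorem IsLinearized.map {L : Type*} [Field L] {F : K[X]} (hF : IsLinearized q r F)
    (f : K →+* L) : IsLinearized q r (F.map f) := by
  intro j hj
  rw [coeff_map] at hj
  exact hF j fun h => hj (by rw [h, map_zero])

theorem isLinearized_modulus (n : ℕ) : IsLinearized q r (modulus K q r n) :=
  (isLinearized_X_pow n).sub isLinearized_X

theorem isLinearized_vecPoly {n : ℕ} (c : Fin n → K) : IsLinearized q r (vecPoly q r c) :=
  IsLinearized.sum fun _ _ => isLinearized_monomial _ _

theorem isLinearized_perp (F : K[X]) : IsLinearized q r (perp q r F) :=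
  IsLinearized.sum fun _ _ => isLinearized_monomial _ _

theorem q_pow_mul_injective (hq : 1 < q) (hr : 0 < r) :
    Function.Injective fun i : ℕ => q ^ (r * i) := fun _ _ h =>
  Nat.eq_of_mul_eq_mul_left hr (Nat.pow_right_injective hq h)

theorem q_pow_mul_lt_iff (hq : 1 < q) (hr : 0 < r) {i j : ℕ} :
    q ^ (r * i) < q ^ (r * j) ↔ i < j := by
  rw [Nat.pow_lt_pow_iff_right hq, Nat.mul_lt_mul_left hr]

/-- The bridge that lets the degree theory of `K[X]` replace arguments with the `q^r`-degree. The
zero polynomial is excluded because there `qDeg` takes the default value `0` of an empty supremum.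
-/
theorem IsLinearized.natDegree_eq (hq : 1 < q) (hr : 0 < r) {F : K[X]}
    (hF : IsLinearized q r F) (h0 : F ≠ 0) : F.natDegree = q ^ (r * qDeg q r F) := by
  obtain ⟨d, hd⟩ := hF F.natDegree (by simpa using h0)
  suffices qDeg q r F = d by rw [this, hd]
  refine IsGreatest.csSup_eq ⟨?_, fun e he => ?_⟩
  · rw [Set.mem_ofPred_eq, ← hd]
    simpa using h0
  · have := le_natDegree_of_ne_zero he
    rw [hd] at this
    exact not_lt.1 fun h => this.not_gt ((q_pow_mul_lt_iff hq hr).2 h)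

theorem IsLinearized.qDeg_eq_of_natDegree (hq : 1 < q) (hr : 0 < r) {F : K[X]}
    (hF : IsLinearized q r F) {d : ℕ} (h : F.natDegree = q ^ (r * d)) : qDeg q r F = d := by
  have h0 : F ≠ 0 := by
    rintro rfl
    exact (pow_pos (by omega : 0 < q) (r * d)).ne (by simpa using h)
  exact q_pow_mul_injective hq hr ((hF.natDegree_eq hq hr h0).symm.trans h)

theorem IsLinearized.natDegree_pos (hq : 1 < q) {F : K[X]} (hF : IsLinearized q r F)
    (h0 : F ≠ 0) : 0 < F.natDegree := by
  obtain ⟨d, hd⟩ := hF F.natDegree (by simpa using h0)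
  rw [hd]
  exact pow_pos (by omega) _

theorem IsLinearized.coeff_zero (hq : 1 < q) {F : K[X]} (hF : IsLinearized q r F) :
    F.coeff 0 = 0 := by
  by_contra h
  obtain ⟨d, hd⟩ := hF 0 h
  exact (pow_pos (by omega : 0 < q) (r * d)).ne hd

theorem IsLinearized.eq_sum (hq : 1 < q) (hr : 0 < r) {F : K[X]} (hF : IsLinearized q r F)
    {N : ℕ} (hN : qDeg q r F < N) :
    F = ∑ i ∈ Finset.range N, C (F.coeff (q ^ (r * i))) * X ^ q ^ (r * i) := by
  by_cases h0 : F = 0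
  · subst h0; simp
  ext j
  simp only [finsetSum_coeff, coeff_C_mul, coeff_X_pow, mul_ite, mul_one, mul_zero]
  by_cases hj : ∃ i, j = q ^ (r * i)
  · obtain ⟨i, rfl⟩ := hj
    simp only [(q_pow_mul_injective hq hr).eq_iff]
    rw [Finset.sum_ite_eq]
    split_ifs with h
    · rfl
    · apply coeff_eq_zero_of_natDegree_lt
      rw [hF.natDegree_eq hq hr h0, q_pow_mul_lt_iff hq hr]
      rw [Finset.mem_range] at h
      omega
  · rw [Finset.sum_eq_zero fun i _ => if_neg fun h => hj ⟨i, h⟩]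
    by_contra h
    exact hj (hF j h)

theorem dvd_comp_of_isLinearized (hq : 1 < q) {Q : K[X]} (hQ : IsLinearized q r Q) (A : K[X]) :
    A ∣ Q.comp A := by
  obtain ⟨Q', rfl⟩ := X_dvd_iff.2 (hQ.coeff_zero hq)
  simp

theorem natDegree_modulus (hq : 1 < q) (hr : 0 < r) {n : ℕ} (hn : 0 < n) :
    (modulus K q r n).natDegree = q ^ (r * n) :=
  FiniteField.X_pow_card_sub_X_natDegree_eq K (Nat.one_lt_pow (by positivity) hq)

theorem modulus_ne_zero (hq : 1 < q) (hr : 0 < r) {n : ℕ} (hn : 0 < n) :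
    modulus K q r n ≠ 0 :=
  FiniteField.X_pow_card_sub_X_ne_zero K (Nat.one_lt_pow (by positivity) hq)

theorem coeff_vecPoly (hq : 1 < q) (hr : 0 < r) {n : ℕ} (c : Fin n → K) (i : Fin n) :
    (vecPoly q r c).coeff (q ^ (r * (i : ℕ))) = c i := by
  simp [vecPoly, finsetSum_coeff, coeff_X_pow, (q_pow_mul_injective hq hr).eq_iff, ← Fin.ext_iff]

theorem degree_vecPoly_lt (hq : 1 < q) (hr : 0 < r) {n : ℕ} (c : Fin n → K) :
    (vecPoly q r c).degree < (q ^ (r * n) : ℕ) := by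
  refine (degree_sum_le _ _).trans_lt ((Finset.sup_lt_iff (WithBot.bot_lt_coe _)).2 fun i _ => ?_)
  refine (degree_C_mul_X_pow_le _ _).trans_lt ?_
  exact_mod_cast (q_pow_mul_lt_iff hq hr).2 i.2

theorem exists_vecPoly_eq (hq : 1 < q) (hr : 0 < r) {n : ℕ} {F : K[X]} (hF : IsLinearized q r F)
    (hdeg : F.degree < (q ^ (r * n) : ℕ)) : ∃ c : Fin n → K, vecPoly q r c = F := by
  refine ⟨fun i => F.coeff (q ^ (r * (i : ℕ))), ?_⟩
  by_cases h0 : F = 0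
  · simp [h0, vecPoly]
  · have : qDeg q r F < n := by
      rw [degree_eq_natDegree h0, hF.natDegree_eq hq hr h0] at hdeg
      exact (q_pow_mul_lt_iff hq hr).1 (by exact_mod_cast hdeg)
    conv_rhs => rw [hF.eq_sum hq hr this, Finset.sum_range]
    rfl

end Linearized

/-! ### Right division, principal left ideals, gcd and lcm. -/

section Composition

variable (Fq : Type*) {K : Type*} [Field Fq] [Fintype Fq] [Field K] [Algebra Fq K] {r : ℕ}

local notation "𝐪" => Fintype.card Fq

theorem IsLinearized.pow {F : K[X]} (hF : IsLinearized 𝐪 r F) (i : ℕ) :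
    IsLinearized 𝐪 r (F ^ 𝐪 ^ (r * i)) := by
  refine hF.induction (P := fun F => IsLinearized 𝐪 r (F ^ 𝐪 ^ (r * i))) ?_ ?_ ?_
  · rw [zero_pow (pow_pos Fintype.card_pos _).ne']
    exact isLinearized_zero
  · intro A B hA hB
    rw [add_pow_card_pow]
    exact hA.add hB
  · intro a j
    rw [mul_pow, ← pow_mul, ← pow_add, ← C_pow, ← mul_add]
    exact isLinearized_monomial _ _

theorem IsLinearized.comp {A B : K[X]} (hA : IsLinearized 𝐪 r A) (hB : IsLinearized 𝐪 r B) :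
    IsLinearized 𝐪 r (A.comp B) := by
  refine hA.induction (P := fun A => IsLinearized 𝐪 r (A.comp B)) ?_ ?_ ?_
  · simpa using isLinearized_zero
  · intro A A' h h'
    simpa using h.add h'
  · intro a i
    simpa using (hB.pow Fq i).C_mul a

theorem exists_right_division (hr : 0 < r) {A : K[X]} (hA : IsLinearized 𝐪 r A) (hA0 : A ≠ 0)
    {B : K[X]} (hB : IsLinearized 𝐪 r B) :
    ∃ Q, IsLinearized 𝐪 r Q ∧ (B - Q.comp A).degree < A.degree := by
  have hq : 1 < 𝐪 := Fintype.one_lt_card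
  induction hd : B.natDegree using Nat.strong_induction_on generalizing B with
  | _ d ih =>
  subst hd
  by_cases hlt : B.degree < A.degree
  · exact ⟨0, isLinearized_zero, by simpa using hlt⟩
  have hB0 : B ≠ 0 := by
    rintro rfl
    exact hlt (by simpa [bot_lt_iff_ne_bot] using hA0)
  have hle : qDeg 𝐪 r A ≤ qDeg 𝐪 r B := by
    rw [degree_eq_natDegree hA0, degree_eq_natDegree hB0, hA.natDegree_eq hq hr hA0,
      hB.natDegree_eq hq hr hB0] at hlt
    exact not_lt.1 fun h => hlt (by exact_mod_cast (q_pow_mul_lt_iff hq hr).2 h)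
  obtain ⟨e, he⟩ := Nat.exists_eq_add_of_le hle
  have hlc : A.leadingCoeff ≠ 0 := leadingCoeff_ne_zero.2 hA0
  -- Composing `x^{[re]}` with `A` raises the leading coefficient of `A` to the power `[re]`; this
  -- scalar makes the leading terms of `Q₀.comp A` and `B` cancel.
  set Q₀ : K[X] := C (B.leadingCoeff / A.leadingCoeff ^ 𝐪 ^ (r * e)) * X ^ 𝐪 ^ (r * e) with hQ₀
  have hcomp : Q₀.comp A = C (B.leadingCoeff / A.leadingCoeff ^ 𝐪 ^ (r * e)) * A ^ 𝐪 ^ (r * e) := by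
    simp [hQ₀]
  have hc0 : B.leadingCoeff / A.leadingCoeff ^ 𝐪 ^ (r * e) ≠ 0 :=
    div_ne_zero (leadingCoeff_ne_zero.2 hB0) (pow_ne_zero _ hlc)
  have hne : Q₀.comp A ≠ 0 := by
    rw [hcomp]
    exact mul_ne_zero (C_ne_zero.2 hc0) (pow_ne_zero _ hA0)
  have hdeg : B.degree = (Q₀.comp A).degree := by
    rw [degree_eq_natDegree hB0, degree_eq_natDegree hne, hcomp, natDegree_C_mul hc0,
      natDegree_pow, hA.natDegree_eq hq hr hA0, hB.natDegree_eq hq hr hB0, he, ← pow_add,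
      ← mul_add, add_comm e]
  have hsub : (B - Q₀.comp A).degree < B.degree := by
    refine degree_sub_lt_left hdeg hB0 ?_
    rw [hcomp, leadingCoeff_mul, leadingCoeff_C, leadingCoeff_pow,
      div_mul_cancel₀ _ (pow_ne_zero _ hlc)]
  have hQ₀l : IsLinearized 𝐪 r Q₀ := isLinearized_monomial _ _
  by_cases hz : B - Q₀.comp A = 0
  · refine ⟨Q₀, hQ₀l, ?_⟩
    rw [hz, degree_zero, bot_lt_iff_ne_bot]
    simpa using hA0
  obtain ⟨Q, hQ, h⟩ := ih _ (natDegree_lt_natDegree hz hsub) (hB.sub (hQ₀l.comp Fq hA)) rfl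
  refine ⟨Q₀ + Q, hQ₀l.add hQ, ?_⟩
  rwa [add_comp, ← sub_sub]

/-- For linearized polynomials divisibility on the right is the usual divisibility. -/
theorem rightDvd_iff_dvd (hr : 0 < r) {A B : K[X]} (hA : IsLinearized 𝐪 r A)
    (hB : IsLinearized 𝐪 r B) : RightDvd 𝐪 r A B ↔ A ∣ B := by
  have hq : 1 < 𝐪 := Fintype.one_lt_card
  constructor
  · rintro ⟨Q, hQ, rfl⟩
    exact dvd_comp_of_isLinearized hq hQ A
  · intro h
    by_cases hA0 : A = 0
    · subst hA0
      exact ⟨0, isLinearized_zero, by simpa using h⟩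
    obtain ⟨Q, hQ, hlt⟩ := exists_right_division Fq hr hA hA0 hB
    refine ⟨Q, hQ, sub_eq_zero.1 ?_⟩
    -- The remainder of the right division is an ordinary multiple of `A` of smaller degree, hence
    -- zero.
    exact eq_zero_of_dvd_of_degree_lt (dvd_sub h (dvd_comp_of_isLinearized hq hQ A)) hlt

/-- Left ideals of the ring of linearized polynomials are principal. -/
theorem exists_monic_generator (hr : 0 < r) (S : Submodule K K[X])
    (hS : ∀ F ∈ S, IsLinearized 𝐪 r F) (hpow : ∀ F ∈ S, F ^ 𝐪 ^ r ∈ S) (h0 : ∃ F ∈ S, F ≠ 0) :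
    ∃ D ∈ S, D.Monic ∧ (∀ F ∈ S, D ∣ F) ∧ ∀ F, IsLinearized 𝐪 r F → D ∣ F → F ∈ S := by
  classical
  -- Stability under scalars and under `F ↦ F^{[r]}`, which is left composition with `x^{[r]}`,
  -- makes `S` a left ideal.
  have hcomp : ∀ Q, IsLinearized 𝐪 r Q → ∀ F ∈ S, Q.comp F ∈ S := by
    intro Q hQ F hF
    refine hQ.induction (P := fun Q => Q.comp F ∈ S) (by simp) ?_ ?_
    · intro A B hA hB
      simpa using S.add_mem hA hB
    · intro a i
      have : F ^ 𝐪 ^ (r * i) ∈ S := by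
        induction i with
        | zero => simpa using hF
        | succ i ih =>
          have := hpow _ ih
          rwa [← pow_mul, ← pow_add, ← mul_add_one] at this
      simpa [← smul_eq_C_mul] using S.smul_mem a this
  have hex : ∃ d, ∃ F ∈ S, F ≠ 0 ∧ F.natDegree = d := by
    obtain ⟨F, hF, hF0⟩ := h0
    exact ⟨_, F, hF, hF0, rfl⟩
  obtain ⟨F, hF, hF0, hFd⟩ := Nat.find_spec hex
  have hlc := leadingCoeff_ne_zero.2 hF0
  have hDS : C F.leadingCoeff⁻¹ * F ∈ S := by
    rw [← smul_eq_C_mul]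
    exact S.smul_mem _ hF
  have hDm : (C F.leadingCoeff⁻¹ * F).Monic := by
    rw [Monic, leadingCoeff_mul, leadingCoeff_C, inv_mul_cancel₀ hlc]
  have hDd : (C F.leadingCoeff⁻¹ * F).natDegree = Nat.find hex := by
    rw [natDegree_C_mul (inv_ne_zero hlc), hFd]
  generalize C F.leadingCoeff⁻¹ * F = D at hDS hDm hDd
  refine ⟨D, hDS, hDm, fun B hB => ?_, fun B hB hdvd => ?_⟩
  · obtain ⟨Q, hQ, hlt⟩ := exists_right_division Fq hr (hS D hDS) hDm.ne_zero (hS B hB)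
    have hmem : B - Q.comp D ∈ S := S.sub_mem hB (hcomp Q hQ D hDS)
    have hz : B - Q.comp D = 0 := by
      by_contra hz
      exact Nat.find_min hex (hDd ▸ natDegree_lt_natDegree hz hlt) ⟨_, hmem, hz, rfl⟩
    rw [sub_eq_zero.1 hz]
    exact dvd_comp_of_isLinearized Fintype.one_lt_card hQ D
  · obtain ⟨Q, hQ, rfl⟩ := (rightDvd_iff_dvd Fq hr (hS D hDS) hB).2 hdvd
    exact hcomp Q hQ D hDS

theorem IsRightGcd.eq {ι : Type*} {F : ι → K[X]} {D D' : K[X]} (hD : IsRightGcd 𝐪 r F D)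
    (hD' : IsRightGcd 𝐪 r F D') (hr : 0 < r) : D = D' :=
  eq_of_monic_of_associated hD.monic hD'.monic <| associated_of_dvd_dvd
    ((rightDvd_iff_dvd Fq hr hD.isLinearized hD'.isLinearized).1
      (hD'.greatest D hD.isLinearized hD.dvd))
    ((rightDvd_iff_dvd Fq hr hD'.isLinearized hD.isLinearized).1
      (hD.greatest D' hD'.isLinearized hD'.dvd))

theorem IsRightLcm.eq {ι : Type*} {F : ι → K[X]} {M M' : K[X]} (hM : IsRightLcm 𝐪 r F M)
    (hM' : IsRightLcm 𝐪 r F M') (hr : 0 < r) : M = M' :=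
  eq_of_monic_of_associated hM.monic hM'.monic <| associated_of_dvd_dvd
    ((rightDvd_iff_dvd Fq hr hM.isLinearized hM'.isLinearized).1
      (hM.least M' hM'.isLinearized hM'.dvd))
    ((rightDvd_iff_dvd Fq hr hM'.isLinearized hM.isLinearized).1
      (hM'.least M hM.isLinearized hM.dvd))

/-- The linearized polynomials satisfying all the divisibility relations `A ∣ F`, `A ∈ T`. -/
def multiples (q r : ℕ) (T : Set K[X]) : Submodule K K[X] where
  carrier := {F | IsLinearized q r F ∧ ∀ A ∈ T, A ∣ F}
  add_mem' h h' := ⟨h.1.add h'.1, fun A hA => dvd_add (h.2 A hA) (h'.2 A hA)⟩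
  zero_mem' := ⟨isLinearized_zero, fun _ _ => dvd_zero _⟩
  smul_mem' a F h := by
    rw [Set.mem_ofPred_eq, smul_eq_C_mul]
    exact ⟨h.1.C_mul a, fun A hA => (h.2 A hA).mul_left _⟩

theorem mem_multiples {q : ℕ} {T : Set K[X]} {F : K[X]} :
    F ∈ multiples q r T ↔ IsLinearized q r F ∧ ∀ A ∈ T, A ∣ F := Iff.rfl

theorem exists_monic_generator_multiples (hr : 0 < r) (T : Set K[X]) {F : K[X]}
    (hF : IsLinearized 𝐪 r F) (hF0 : F ≠ 0) (hTF : ∀ A ∈ T, A ∣ F) :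
    ∃ D, IsLinearized 𝐪 r D ∧ D.Monic ∧ (∀ A ∈ T, A ∣ D) ∧
      ∀ B, IsLinearized 𝐪 r B → (∀ A ∈ T, A ∣ B) → D ∣ B := by
  obtain ⟨D, hDS, hDm, hD, -⟩ := exists_monic_generator Fq hr (multiples 𝐪 r T) (fun _ h => h.1)
    (fun B hB => ⟨by simpa using hB.1.pow Fq 1,
      fun A hA => dvd_pow (hB.2 A hA) (pow_pos Fintype.card_pos _).ne'⟩) ⟨F, ⟨hF, hTF⟩, hF0⟩
  exact ⟨D, hDS.1, hDm, hDS.2, fun B hB hT => hD B ⟨hB, hT⟩⟩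

/-- The gcd is built as the lcm of all common right divisors: the linearized polynomials divisible
by every common divisor form a left ideal that contains each `F i`, so its generator divides each `F
i`. -/
theorem exists_isRightGcd (hr : 0 < r) {ι : Type*} (F : ι → K[X])
    (hF : ∀ i, IsLinearized 𝐪 r (F i)) (h0 : ∃ i, F i ≠ 0) : ∃ D, IsRightGcd 𝐪 r F D := by
  obtain ⟨i₀, hi₀⟩ := h0
  obtain ⟨D, hDl, hDm, hTD, hD⟩ := exists_monic_generator_multiples Fq hr
    {A | IsLinearized 𝐪 r A ∧ ∀ i, RightDvd 𝐪 r A (F i)} (hF i₀) hi₀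
    fun A hA => (rightDvd_iff_dvd Fq hr hA.1 (hF i₀)).1 (hA.2 i₀)
  refine ⟨D, hDl, hDm, fun i => (rightDvd_iff_dvd Fq hr hDl (hF i)).2 (hD _ (hF i) fun A hA => ?_),
    fun A hA h => (rightDvd_iff_dvd Fq hr hA hDl).2 (hTD A ⟨hA, h⟩)⟩
  exact (rightDvd_iff_dvd Fq hr hA.1 (hF i)).1 (hA.2 i)

end Composition


/-! ### Galois descent and the rank length. -/

section RankLength

variable {K : Type*} [Field K] {n : ℕ}

theorem frobVec_zero (q : ℕ) (c : Fin n → K) : frobVec q 0 c = c := by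
  ext j
  simp [frobVec]

theorem frobVec_frobVec (q i j : ℕ) (c : Fin n → K) :
    frobVec q i (frobVec q j c) = frobVec q (j + i) c := by
  ext k
  simp [frobVec, ← pow_mul, pow_add]

theorem IsGaloisClosed.frobVec_mem {q : ℕ} {V : Submodule K (Fin n → K)} (hV : IsGaloisClosed q V)
    (i : ℕ) {c : Fin n → K} (hc : c ∈ V) : frobVec q i c ∈ V := by
  induction i with
  | zero => rwa [frobVec_zero]
  | succ i ih => exact frobVec_frobVec q 1 i c ▸ hV _ ih

variable (Fq : Type*) [Field Fq] [Algebra Fq K]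

/-- The vectors over the base field lying in a space over the extension field. -/
def descent (V : Submodule K (Fin n → K)) : Submodule Fq (Fin n → Fq) :=
  (V.restrictScalars Fq).comap ((Algebra.linearMap Fq K).compLeft (Fin n))

theorem mem_descent {V : Submodule K (Fin n → K)} {v : Fin n → Fq} :
    v ∈ descent Fq V ↔ (fun j => algebraMap Fq K (v j)) ∈ V := Iff.rfl

theorem rankWeight_le_of_matrix {k l : ℕ} (B : Matrix (Fin k) (Fin l) Fq) (x : Fin k → K) :
    rankWeight Fq (Matrix.vecMul x (B.map (algebraMap Fq K))) ≤ rankWeight Fq x := by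
  have : FiniteDimensional Fq (Submodule.span Fq (Set.range x)) :=
    FiniteDimensional.span_of_finite Fq (Set.finite_range x)
  refine Submodule.finrank_mono (Submodule.span_le.2 ?_)
  rintro _ ⟨j, rfl⟩
  simp only [Matrix.vecMul, dotProduct, Matrix.map_apply]
  refine Submodule.sum_mem _ fun i _ => ?_
  rw [mul_comm, ← Algebra.smul_def]
  exact Submodule.smul_mem _ _ (Submodule.subset_span ⟨i, rfl⟩)

variable [Fintype Fq]

local notation "𝐪" => Fintype.card Fq

/-- The trace is the sum of the Frobenius conjugates, all of which stay in a Galois closed space. -/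
theorem trace_mem_descent [Finite K] {V : Submodule K (Fin n → K)} (hV : IsGaloisClosed 𝐪 V)
    {c : Fin n → K} (hc : c ∈ V) : (fun j => Algebra.trace Fq K (c j)) ∈ descent Fq V := by
  rw [mem_descent]
  have : (fun j => algebraMap Fq K (Algebra.trace Fq K (c j))) =
      ∑ i ∈ Finset.range (Module.finrank Fq K), frobVec 𝐪 i c := by
    ext j
    rw [FiniteField.algebraMap_trace_eq_sum_pow, Finset.sum_apply, Nat.card_eq_fintype_card]
    rfl
  rw [this]
  exact V.sum_mem fun i _ => hV.frobVec_mem i hc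

/-- A Galois closed space is generated by its vectors over the base field. -/
theorem IsGaloisClosed.eq_span_descent [Finite K] {V : Submodule K (Fin n → K)}
    (hV : IsGaloisClosed 𝐪 V) :
    V = Submodule.span K ((fun v j => algebraMap Fq K (v j)) '' (descent Fq V : Set (Fin n → Fq))) := by
  classical
  have : FiniteDimensional Fq K := Module.Finite.of_finite
  apply le_antisymm
  · intro c hc
    let b := Module.finBasis Fq K
    -- Expanding each component in the trace-dual basis gives coefficients that are traces of `b i •
    -- c`, hence vectors over `Fq` in `V`.
    have hsum : c = ∑ i, b.traceDual i • fun j => algebraMap Fq K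
        (Algebra.trace Fq K ((b i • c) j)) := by
      ext j
      conv_lhs => rw [← b.traceDual.sum_repr (c j)]
      simp only [Finset.sum_apply, Pi.smul_apply, smul_eq_mul]
      refine Finset.sum_congr rfl fun i _ => ?_
      rw [Module.Basis.traceDual_repr_apply, Algebra.smul_def, mul_comm,
        Algebra.traceForm_apply, mul_comm (c j)]
    rw [hsum]
    refine Submodule.sum_mem _ fun i _ => Submodule.smul_mem _ _ (Submodule.subset_span ⟨_, ?_, rfl⟩)
    exact trace_mem_descent Fq hV (V.smul_mem _ hc)
  · rw [Submodule.span_le]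
    rintro _ ⟨v, hv, rfl⟩
    exact hv

/-- A Galois closed space has the coordinates of a matrix over the base field that has a right
inverse. -/
theorem IsGaloisClosed.exists_matrix [Finite K] {V : Submodule K (Fin n → K)}
    (hV : IsGaloisClosed 𝐪 V) :
    ∃ (k : ℕ) (B : Matrix (Fin k) (Fin n) Fq) (P : Matrix (Fin n) (Fin k) Fq), B * P = 1 ∧
      V = LinearMap.range (Matrix.vecMulLinear (B.map (algebraMap Fq K))) := by
  let b := Module.finBasis Fq (descent Fq V)
  let B : Matrix (Fin (Module.finrank Fq (descent Fq V))) (Fin n) Fq :=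
    Matrix.of fun i => (b i : Fin n → Fq)
  have hB : LinearMap.ker (Matrix.vecMulLinear B) = ⊥ := by
    rw [LinearMap.ker_eq_bot]
    have : LinearIndependent Fq (fun i => (b i : Fin n → Fq)) :=
      b.linearIndependent.map' (descent Fq V).subtype (Submodule.ker_subtype _)
    exact Matrix.vecMul_injective_iff.2 this
  obtain ⟨f, hf⟩ := LinearMap.exists_leftInverse_of_injective _ hB
  refine ⟨_, B, LinearMap.toMatrixRight' f, ?_, ?_⟩
  · apply Matrix.toLinearMapRight'.injective
    rw [Matrix.toLinearMapRight'_mul, Matrix.toLinearMapRight'_one]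
    refine Eq.trans ?_ hf
    exact congrArg (· ∘ₗ B.vecMulLinear) (LinearMap.toMatrixRight'.symm_apply_apply f)
  · apply le_antisymm
    · refine (hV.eq_span_descent Fq).le.trans (Submodule.span_le.2 ?_)
      rintro _ ⟨v, hv, rfl⟩
      refine ⟨fun i => algebraMap Fq K (b.repr ⟨v, hv⟩ i), ?_⟩
      have h := congrArg Subtype.val (b.sum_repr ⟨v, hv⟩)
      ext j
      have hj := congrFun h j
      simp only [Submodule.coe_sum, Submodule.coe_smul, Finset.sum_apply, Pi.smul_apply,
        smul_eq_mul] at hj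
      simp [← hj, Matrix.vecMul, dotProduct, B]
    · rintro _ ⟨x, rfl⟩
      have : Matrix.vecMulLinear (B.map (algebraMap Fq K)) x =
          ∑ i, x i • fun j => algebraMap Fq K ((b i : Fin n → Fq) j) := by
        ext j
        simp [Matrix.vecMul, dotProduct, B]
      rw [this]
      exact V.sum_mem fun i _ => V.smul_mem _ (b i).2

/-- Both the coordinate map of `V` and its inverse are multiplications by matrices over `Fq`.
Neither can increase the rank weight, so both preserve it. -/
theorem rankEquivalent_of_isGaloisClosed [Finite K] {C V : Submodule K (Fin n → K)}
    (hV : IsGaloisClosed 𝐪 V) (hCV : C ≤ V) :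
    ∃ C' : Submodule K (Fin (Module.finrank K V) → K), RankEquivalent Fq C C' := by
  obtain ⟨k, B, P, hBP, hVB⟩ := hV.exists_matrix Fq
  set B' := B.map (algebraMap Fq K) with hB'
  set P' := P.map (algebraMap Fq K) with hP'
  have hBP' : B' * P' = 1 := by
    rw [hB', hP', ← Matrix.map_mul, hBP, Matrix.map_one _ (map_zero _) (map_one _)]
  have hleft : ∀ x, Matrix.vecMul (Matrix.vecMul x B') P' = x := fun x => by
    rw [Matrix.vecMul_vecMul, hBP', Matrix.vecMul_one]
  have hinj : Function.Injective (Matrix.vecMulLinear B') :=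
    Function.LeftInverse.injective (g := Matrix.vecMulLinear P') hleft
  let e : (Fin k → K) ≃ₗ[K] V :=
    (LinearEquiv.ofInjective _ hinj).trans (LinearEquiv.ofEq _ _ hVB.symm)
  have he : ∀ x, (e x : Fin n → K) = Matrix.vecMul x B' := fun x => rfl
  have hk : Module.finrank K V = k := by
    rw [← e.finrank_eq, Module.finrank_fin_fun]
  rw [hk]
  refine ⟨C.comap (V.subtype ∘ₗ e.toLinearMap), V, ⊤, hV, fun _ _ => trivial, hCV, le_top,
    e.symm.trans (LinearEquiv.ofTop ⊤ rfl).symm, fun c => ?_, fun c => ?_⟩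
  · obtain ⟨x, rfl⟩ := e.surjective c
    simp only [LinearEquiv.trans_apply, LinearEquiv.symm_apply_apply]
    change rankWeight Fq x = _
    rw [he]
    refine le_antisymm ?_ (rankWeight_le_of_matrix Fq B x)
    have := rankWeight_le_of_matrix Fq P (Matrix.vecMul x B')
    rwa [← hP', hleft] at this
  · obtain ⟨x, rfl⟩ := e.surjective c
    simp only [LinearEquiv.trans_apply, LinearEquiv.symm_apply_apply]
    rfl

/-- The rank length of a code is the dimension of the smallest Galois closed space
containing it. -/
theorem rankLength_eq_finrank [Finite K] {C V : Submodule K (Fin n → K)}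
    (hV : IsGaloisClosed 𝐪 V) (hCV : C ≤ V)
    (hmin : ∀ V', IsGaloisClosed 𝐪 V' → C ≤ V' → V ≤ V') :
    rankLength Fq C = Module.finrank K V := by
  refine IsLeast.csInf_eq ⟨rankEquivalent_of_isGaloisClosed Fq hV hCV, ?_⟩
  -- For the lower bound only the linear isomorphism matters: `W` contains `V` and embeds into
  -- `K^k`.
  rintro k ⟨C', W, W', hW, -, hCW, -, φ, -⟩
  calc Module.finrank K V ≤ Module.finrank K W := Submodule.finrank_mono (hmin W hW hCW)
    _ = Module.finrank K W' := φ.finrank_eq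
    _ ≤ Module.finrank K (Fin k → K) := Submodule.finrank_le _
    _ = k := Module.finrank_fin_fun K

end RankLength


/-! ### The action of `θ_i` on polynomials. -/

section FrobeniusPoly

variable (Fq : Type*) {K : Type*} [Field Fq] [Fintype Fq] [Field K] [Algebra Fq K] {r : ℕ}

local notation "𝐪" => Fintype.card Fq

theorem frobPoly_eq_map (i : ℕ) (F : K[X]) :
    frobPoly 𝐪 i F = F.map (powHom Fq K i : K →+* K) := by
  ext j
  rw [frobPoly, Polynomial.sum, finsetSum_coeff, coeff_map]
  simp only [coeff_C_mul, coeff_X_pow, mul_ite, mul_one, mul_zero, Finset.sum_ite_eq]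
  rw [RingHom.coe_coe, powHom_apply]
  split_ifs with h
  · rfl
  · rw [notMem_support_iff.1 h, zero_pow (pow_pos Fintype.card_pos _).ne']

theorem coeff_frobPoly (i : ℕ) (F : K[X]) (j : ℕ) :
    (frobPoly 𝐪 i F).coeff j = F.coeff j ^ 𝐪 ^ i := by
  rw [frobPoly_eq_map, coeff_map, RingHom.coe_coe, powHom_apply]

theorem frobPoly_zero (F : K[X]) : frobPoly 𝐪 0 F = F := by
  ext j
  simp [coeff_frobPoly]

theorem frobPoly_frobPoly (i j : ℕ) (F : K[X]) :
    frobPoly 𝐪 i (frobPoly 𝐪 j F) = frobPoly 𝐪 (j + i) F := by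
  ext k
  simp [coeff_frobPoly, ← pow_mul, pow_add]

theorem pow_card_pow_finrank [Finite K] (a : K) : a ^ 𝐪 ^ Module.finrank Fq K = a := by
  have := Fintype.ofFinite K
  rw [← Module.card_eq_pow_finrank (K := Fq) (V := K), FiniteField.pow_card]

theorem frobPoly_finrank [Finite K] (F : K[X]) :
    frobPoly 𝐪 (Module.finrank Fq K) F = F := by
  ext k
  rw [coeff_frobPoly, pow_card_pow_finrank]

theorem isLinearized_frobPoly {F : K[X]} (hF : IsLinearized 𝐪 r F) (i : ℕ) :
    IsLinearized 𝐪 r (frobPoly 𝐪 i F) := by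
  rw [frobPoly_eq_map]
  exact hF.map _

theorem frobPoly_comp (i : ℕ) (A B : K[X]) :
    frobPoly 𝐪 i (A.comp B) = (frobPoly 𝐪 i A).comp (frobPoly 𝐪 i B) := by
  simp only [frobPoly_eq_map, Polynomial.map_comp]

theorem frobPoly_modulus (i n : ℕ) :
    frobPoly 𝐪 i (modulus K 𝐪 r n) = modulus K 𝐪 r n := by
  simp [frobPoly_eq_map, modulus]

theorem frobPoly_vecPoly (i : ℕ) {n : ℕ} (c : Fin n → K) :
    frobPoly 𝐪 i (vecPoly 𝐪 r c) = vecPoly 𝐪 r (frobVec 𝐪 i c) := by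
  simp [frobPoly_eq_map, vecPoly, frobVec, Polynomial.map_sum, powHom_apply]

theorem frobPoly_monic {F : K[X]} (hF : F.Monic) (i : ℕ) : (frobPoly 𝐪 i F).Monic := by
  rw [frobPoly_eq_map]
  exact hF.map _

theorem natDegree_frobPoly (F : K[X]) (i : ℕ) : (frobPoly 𝐪 i F).natDegree = F.natDegree := by
  rw [frobPoly_eq_map, natDegree_map]

theorem qDeg_frobPoly (F : K[X]) (i : ℕ) : qDeg 𝐪 r (frobPoly 𝐪 i F) = qDeg 𝐪 r F := by
  simp only [qDeg, coeff_frobPoly, ne_eq, pow_eq_zero_iff (pow_pos Fintype.card_pos _).ne']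

theorem frobPoly_dvd {A B : K[X]} (h : A ∣ B) (i : ℕ) : frobPoly 𝐪 i A ∣ frobPoly 𝐪 i B := by
  simp only [frobPoly_eq_map]
  exact Polynomial.map_dvd _ h

theorem frobPoly_perp (F : K[X]) (i : ℕ) :
    frobPoly 𝐪 i (perp 𝐪 r F) = perp 𝐪 r (frobPoly 𝐪 i F) := by
  rw [perp, perp, qDeg_frobPoly, frobPoly_eq_map, Polynomial.map_sum]
  refine Finset.sum_congr rfl fun j _ => ?_
  simp only [Polynomial.map_mul, map_C, Polynomial.map_pow, map_X, RingHom.coe_coe, map_div₀,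
    map_pow, coeff_frobPoly, powHom_apply]

end FrobeniusPoly

/-! ### Skew cyclic codes as left ideals. -/

section CodeIdeal

variable {K : Type*} [Field K] {r n : ℕ}

/-- The linear map attaching to a vector its linearized polynomial. -/
noncomputable def vecPolyLin (K : Type*) [Field K] (q r n : ℕ) : (Fin n → K) →ₗ[K] K[X] where
  toFun := vecPoly q r
  map_add' c c' := by simp [vecPoly, add_mul, Finset.sum_add_distrib]
  map_smul' a c := by simp [vecPoly, smul_eq_C_mul, Finset.mul_sum, mul_assoc]

theorem vecPolyLin_apply (q : ℕ) (c : Fin n → K) : vecPolyLin K q r n c = vecPoly q r c := rfl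

/-- The linearized polynomials with residue class in a code. -/
def codeIdeal (q r : ℕ) (C : Submodule K (Fin n → K)) : Submodule K K[X] where
  carrier := {F | MemCode q r C F}
  add_mem' := by
    rintro _ _ ⟨c, hc, A, hA, rfl⟩ ⟨c', hc', A', hA', rfl⟩
    refine ⟨c + c', C.add_mem hc hc', A + A', hA.add hA', ?_⟩
    rw [← vecPolyLin_apply, ← vecPolyLin_apply, ← vecPolyLin_apply, map_add, add_comp]
    ring
  zero_mem' := ⟨0, C.zero_mem, 0, isLinearized_zero, by simp [vecPoly]⟩
  smul_mem' := by
    rintro a _ ⟨c, hc, A, hA, rfl⟩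
    refine ⟨a • c, C.smul_mem a hc, Polynomial.C a * A, hA.C_mul a, ?_⟩
    rw [← vecPolyLin_apply, ← vecPolyLin_apply, map_smul, mul_comp, C_comp, smul_add,
      smul_eq_C_mul a (p := A.comp _)]

theorem vecPoly_mem_codeIdeal {q : ℕ} {C : Submodule K (Fin n → K)} {c : Fin n → K} (hc : c ∈ C) :
    vecPoly q r c ∈ codeIdeal q r C :=
  ⟨c, hc, 0, isLinearized_zero, by simp⟩

/-- A polynomial `vecPoly c` has degree below `q^{rn}`, so it is the only representative of that
kind in its class: two of them cannot differ by a nonzero multiple of the modulus. -/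
theorem mem_of_vecPoly_mem_codeIdeal {q : ℕ} (hq : 1 < q) (hr : 0 < r) (hn : 0 < n)
    {C : Submodule K (Fin n → K)} {c : Fin n → K} (h : vecPoly q r c ∈ codeIdeal q r C) : c ∈ C := by
  obtain ⟨c', hc', A, hA, h⟩ := h
  have h' : vecPoly q r (c - c') = A.comp (modulus K q r n) := by
    rw [← vecPolyLin_apply, map_sub, vecPolyLin_apply, vecPolyLin_apply, h]
    ring
  have hz : vecPoly q r (c - c') = 0 := by
    refine eq_zero_of_dvd_of_degree_lt (p := modulus K q r n) ?_ ?_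
    · rw [h']
      exact dvd_comp_of_isLinearized hq hA _
    · rw [degree_eq_natDegree (modulus_ne_zero hq hr hn), natDegree_modulus hq hr hn]
      exact degree_vecPoly_lt hq hr _
  have : c = c' := by
    rw [← sub_eq_zero]
    ext i
    rw [← coeff_vecPoly hq hr (c - c') i, hz]
    simp
  rwa [this]

variable (Fq : Type*) [Field Fq] [Fintype Fq] [Algebra Fq K]

local notation "𝐪" => Fintype.card Fq

/-- The power `[r]` moves each coefficient one place up and applies `θ_r`. The top term lands on
`x^{[rn]}`, and subtracting `c_{n-1}^{[r]}` times the modulus wraps it around to `x`. -/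
theorem vecPoly_pow (c : Fin n → K) (hn : 0 < n) :
    ∃ a : K, vecPoly 𝐪 r c ^ 𝐪 ^ r =
      vecPoly 𝐪 r (frobVec 𝐪 r (shift c)) + C a * modulus K 𝐪 r n := by
  obtain ⟨k, rfl⟩ : ∃ k, n = k + 1 := ⟨n - 1, by omega⟩
  refine ⟨c (Fin.last k) ^ 𝐪 ^ r, ?_⟩
  have h0 : shift c 0 = c (Fin.last k) := by
    rw [shift, (finRotate (k + 1)).symm_apply_eq.2 finRotate_last.symm]
  have hs : ∀ j : Fin k, shift c j.succ = c j.castSucc := fun j => by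
    rw [shift, (finRotate (k + 1)).symm_apply_eq.2]
    exact (finRotate_of_lt j.2).symm
  rw [vecPoly, sum_pow_card_pow, Fin.sum_univ_castSucc, vecPoly, Fin.sum_univ_succ]
  simp only [frobVec, h0, hs, modulus, mul_pow, ← C_pow, ← pow_mul, ← pow_add, Fin.val_castSucc,
    Fin.val_last, Fin.val_zero, Fin.val_succ, mul_zero, pow_zero, pow_one, mul_add_one]
  ring

theorem isLinearized_of_mem_codeIdeal {C : Submodule K (Fin n → K)} {F : K[X]}
    (hF : F ∈ codeIdeal 𝐪 r C) : IsLinearized 𝐪 r F := by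
  obtain ⟨c, -, A, hA, rfl⟩ := hF
  exact (isLinearized_vecPoly c).add (hA.comp Fq (isLinearized_modulus n))

theorem pow_mem_codeIdeal (hn : 0 < n) {C : Submodule K (Fin n → K)} (hC : IsSkewCyclic 𝐪 r C)
    {F : K[X]} (hF : F ∈ codeIdeal 𝐪 r C) : F ^ 𝐪 ^ r ∈ codeIdeal 𝐪 r C := by
  obtain ⟨c, hc, A, hA, rfl⟩ := hF
  obtain ⟨a, ha⟩ := vecPoly_pow Fq (r := r) c hn
  refine ⟨_, hC c hc, A ^ 𝐪 ^ r + Polynomial.C a * X, ?_, ?_⟩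
  · refine IsLinearized.add ?_ (isLinearized_X.C_mul a)
    simpa using hA.pow Fq 1
  · rw [add_pow_card_pow, ha]
    simp
    ring

theorem exists_codeIdeal_generator (hr : 0 < r) (hn : 0 < n) {C : Submodule K (Fin n → K)}
    (hC : IsSkewCyclic 𝐪 r C) :
    ∃ D ∈ codeIdeal 𝐪 r C, D.Monic ∧ (∀ F ∈ codeIdeal 𝐪 r C, D ∣ F) ∧
      ∀ F, IsLinearized 𝐪 r F → D ∣ F → F ∈ codeIdeal 𝐪 r C :=
  exists_monic_generator Fq hr _ (fun _ => isLinearized_of_mem_codeIdeal Fq)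
    (fun _ => pow_mem_codeIdeal Fq hn hC)
    ⟨modulus K 𝐪 r n, ⟨0, C.zero_mem, X, isLinearized_X, by simp [vecPoly]⟩,
      modulus_ne_zero Fintype.one_lt_card hr hn⟩

/-- The generator of minimal degree must coincide with the monic generator of the left ideal, since
it is a monic multiple of that generator and has no larger degree. -/
theorem IsGeneratorPoly.dvd (hr : 0 < r) (hn : 0 < n) {C : Submodule K (Fin n → K)}
    (hC : IsSkewCyclic 𝐪 r C) {G : K[X]} (hG : IsGeneratorPoly 𝐪 r C G) {F : K[X]}
    (hF : F ∈ codeIdeal 𝐪 r C) : G ∣ F := by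
  have hq : 1 < 𝐪 := Fintype.one_lt_card
  obtain ⟨D, hDC, hDm, hD, -⟩ := exists_codeIdeal_generator Fq hr hn hC
  have hle := hG.minimal D hDm.ne_zero hDC
  have hDl := isLinearized_of_mem_codeIdeal Fq hDC
  have hdeg : G.natDegree ≤ D.natDegree := by
    rw [hG.isLinearized.natDegree_eq hq hr hG.monic.ne_zero, hDl.natDegree_eq hq hr hDm.ne_zero]
    exact Nat.pow_le_pow_right Fintype.card_pos (Nat.mul_le_mul_left _ hle)
  have : G = D := (eq_of_monic_of_dvd_of_natDegree_le hDm hG.monic (hD G hG.mem) hdeg)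
  rw [this]
  exact hD F hF

/-- `θ_i` respects composition and fixes the modulus, so it acts on residue classes as it acts on
vectors. -/
theorem frobPoly_mem_codeIdeal {C V : Submodule K (Fin n → K)} (hV : IsGaloisClosed 𝐪 V)
    (hCV : C ≤ V) {F : K[X]} (hF : F ∈ codeIdeal 𝐪 r C) (i : ℕ) :
    frobPoly 𝐪 i F ∈ codeIdeal 𝐪 r V := by
  obtain ⟨c, hc, A, hA, rfl⟩ := hF
  refine ⟨frobVec 𝐪 i c, hV.frobVec_mem i (hCV hc), frobPoly 𝐪 i A,
    isLinearized_frobPoly Fq hA i, ?_⟩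
  nth_rewrite 2 [← frobPoly_modulus Fq i n]
  rw [← frobPoly_comp, ← frobPoly_vecPoly]
  simp only [frobPoly_eq_map, Polynomial.map_add]

end CodeIdeal

/-! ### The Galois closure of a cyclic code and its generator. -/

section GaloisClosure

variable (Fq : Type*) {K : Type*} [Field Fq] [Fintype Fq] [Field K] [Algebra Fq K] {r n : ℕ}

local notation "𝐪" => Fintype.card Fq

/-- The intersection of the Galois closed spaces containing a code. -/
def galoisClosure (q : ℕ) (C : Submodule K (Fin n → K)) : Submodule K (Fin n → K) :=
  sInf {V | IsGaloisClosed q V ∧ C ≤ V}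

theorem le_galoisClosure (q : ℕ) (C : Submodule K (Fin n → K)) : C ≤ galoisClosure q C :=
  le_sInf fun _ hV => hV.2

theorem galoisClosure_le {q : ℕ} {C V : Submodule K (Fin n → K)} (hV : IsGaloisClosed q V)
    (hCV : C ≤ V) : galoisClosure q C ≤ V :=
  sInf_le ⟨hV, hCV⟩

theorem isGaloisClosed_galoisClosure (q : ℕ) (C : Submodule K (Fin n → K)) :
    IsGaloisClosed q (galoisClosure q C) := by
  intro c hc
  refine Submodule.mem_sInf.2 fun V hV => hV.1 c (galoisClosure_le hV.1 hV.2 hc)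

/-- The cyclic operator is semilinear and commutes with `θ_1`, so the preimage of the closure under
it is again a Galois closed space containing `C`. By minimality it contains the closure. -/
theorem isSkewCyclic_galoisClosure {C : Submodule K (Fin n → K)} (hC : IsSkewCyclic 𝐪 r C) :
    IsSkewCyclic 𝐪 r (galoisClosure 𝐪 C) := by
  let V : Submodule K (Fin n → K) :=
    { carrier := {c | frobVec 𝐪 r (shift c) ∈ galoisClosure 𝐪 C}
      add_mem' := by
        intro c c' hc hc'
        have : frobVec 𝐪 r (shift (c + c')) = frobVec 𝐪 r (shift c) + frobVec 𝐪 r (shift c') := by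
          ext j
          simp only [frobVec, shift, Pi.add_apply, add_pow_card_pow]
        rw [Set.mem_ofPred_eq, this]
        exact Submodule.add_mem _ hc hc'
      zero_mem' := by
        have : frobVec 𝐪 r (shift (0 : Fin n → K)) = 0 := by
          ext j
          simp [frobVec, shift]
        rw [Set.mem_ofPred_eq, this]
        exact Submodule.zero_mem _
      smul_mem' := by
        intro a c hc
        have : frobVec 𝐪 r (shift (a • c)) = (a ^ 𝐪 ^ r) • frobVec 𝐪 r (shift c) := by
          ext j
          simp only [frobVec, shift, Pi.smul_apply, smul_eq_mul, mul_pow]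
        rw [Set.mem_ofPred_eq, this]
        exact Submodule.smul_mem _ _ hc }
  have hV : IsGaloisClosed 𝐪 V := by
    intro c hc
    change frobVec 𝐪 r (shift (frobVec 𝐪 1 c)) ∈ galoisClosure 𝐪 C
    have : frobVec 𝐪 r (shift (frobVec 𝐪 1 c)) = frobVec 𝐪 1 (frobVec 𝐪 r (shift c)) := by
      ext j
      simp only [frobVec, shift, ← pow_mul, mul_comm]
    rw [this]
    exact isGaloisClosed_galoisClosure _ _ _ hc
  exact fun c hc => galoisClosure_le hV (fun c hc => le_galoisClosure _ _ (hC c hc)) hc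

variable {Fq}

/-- `θ_1` permutes the conjugates of `G` cyclically, so `θ_1(D)` is again a common divisor. It thus
divides `D`, and both are monic of the same degree. -/
theorem frobPoly_one_gcd [Finite K] (hr : 0 < r) {m : ℕ} (hm : 0 < m)
    (hK : Module.finrank Fq K = m) {G D : K[X]} (hG : IsLinearized 𝐪 r G)
    (hD : IsRightGcd 𝐪 r (fun i : Fin m => frobPoly 𝐪 i G) D) : frobPoly 𝐪 1 D = D := by
  have hl := isLinearized_frobPoly Fq hD.isLinearized 1
  have hdvd : ∀ i : Fin m, D ∣ frobPoly 𝐪 i G := fun i =>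
    (rightDvd_iff_dvd Fq hr hD.isLinearized (isLinearized_frobPoly Fq hG i)).1 (hD.dvd i)
  symm
  refine eq_of_monic_of_dvd_of_natDegree_le (frobPoly_monic Fq hD.monic 1) hD.monic ?_
    (natDegree_frobPoly Fq D 1).ge
  refine (rightDvd_iff_dvd Fq hr hl hD.isLinearized).1 (hD.greatest _ hl fun i => ?_)
  refine (rightDvd_iff_dvd Fq hr hl (isLinearized_frobPoly Fq hG i)).2 ?_
  by_cases hi : (i : ℕ) = 0
  -- The wrap-around case: applying `θ_1` to the conjugate of index `m - 1` gives `θ_m(G) = G`.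
  · have := frobPoly_dvd Fq (hdvd ⟨m - 1, by omega⟩) 1
    rw [frobPoly_frobPoly, Nat.sub_add_cancel hm, ← hK, frobPoly_finrank] at this
    rwa [hi, frobPoly_zero]
  · have := frobPoly_dvd Fq (hdvd ⟨i - 1, by omega⟩) 1
    rwa [frobPoly_frobPoly, Nat.sub_add_cancel (by omega)] at this

theorem qDeg_comp (hr : 0 < r) {A B : K[X]} (hA : IsLinearized 𝐪 r A)
    (hB : IsLinearized 𝐪 r B) (hA0 : A ≠ 0) (hB0 : B ≠ 0) :
    qDeg 𝐪 r (A.comp B) = qDeg 𝐪 r A + qDeg 𝐪 r B := by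
  have hq : 1 < 𝐪 := Fintype.one_lt_card
  refine (hA.comp Fq hB).qDeg_eq_of_natDegree hq hr ?_
  rw [natDegree_comp, hA.natDegree_eq hq hr hA0, hB.natDegree_eq hq hr hB0, ← pow_add, mul_add]

theorem comp_left_injective {D : K[X]} (hD : 0 < D.natDegree) :
    Function.Injective (aeval D : K[X] →ₐ[K] K[X]) := by
  rw [injective_iff_map_eq_zero]
  intro F hF
  rw [← comp_eq_aeval, comp_eq_zero_iff] at hF
  refine hF.resolve_right fun h => hD.ne' ?_
  rw [h.2, natDegree_C]

/-- The multiples of `D` of `q^r`-degree below `n` are the `Q.comp D` with `Q` of `q^r`-degree below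
`d = n - deg D`, and composition on the right with `D` is injective. So they are parametrized by
`K^d`. -/
theorem finrank_comap_multiples (hr : 0 < r) {D : K[X]} (hD : IsLinearized 𝐪 r D)
    (hDm : D.Monic) (hDn : qDeg 𝐪 r D ≤ n) :
    Module.finrank K ((multiples 𝐪 r {D}).comap (vecPolyLin K 𝐪 r n)) = n - qDeg 𝐪 r D := by
  have hq : 1 < 𝐪 := Fintype.one_lt_card
  have hpos := hD.natDegree_pos hq hDm.ne_zero
  obtain ⟨d, hd⟩ := Nat.exists_eq_add_of_le hDn
  have hinj : ∀ k, Function.Injective (vecPolyLin K 𝐪 r k) := fun k c c' h => by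
    ext i
    rw [← coeff_vecPoly hq hr c i, ← coeff_vecPoly hq hr c' i]
    exact congrArg (fun F : K[X] => F.coeff _) h
  have hdeg : D.natDegree = 𝐪 ^ (r * qDeg 𝐪 r D) := hD.natDegree_eq hq hr hDm.ne_zero
  have hrange : ((multiples 𝐪 r {D}).comap (vecPolyLin K 𝐪 r n)).map (vecPolyLin K 𝐪 r n) =
      LinearMap.range ((aeval D : K[X] →ₐ[K] K[X]).toLinearMap ∘ₗ vecPolyLin K 𝐪 r d) := by
    have hlt : ∀ F : K[X], (F.comp D).degree < (𝐪 ^ (r * n) : ℕ) ↔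
        F.degree < (𝐪 ^ (r * d) : ℕ) := by
      intro F
      by_cases hF : F = 0
      · subst hF
        simp only [zero_comp, degree_zero, WithBot.bot_lt_natCast]
      have hF' : F.comp D ≠ 0 := fun h => hF (comp_left_injective hpos (h.trans (map_zero _).symm))
      rw [degree_eq_natDegree hF, degree_eq_natDegree hF', natDegree_comp, hdeg, hd, mul_add,
        pow_add, mul_comm]
      norm_cast
      exact Nat.mul_lt_mul_left (pow_pos Fintype.card_pos _)
    ext F
    constructor
    · rintro ⟨c, hc, rfl⟩
      obtain ⟨hl, hdvd⟩ := mem_multiples.1 hc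
      obtain ⟨Q, hQ, h⟩ := (rightDvd_iff_dvd Fq hr hD hl).2 (hdvd D rfl)
      have hQd : Q.degree < (𝐪 ^ (r * d) : ℕ) := by
        rw [← hlt, ← h]
        exact degree_vecPoly_lt hq hr c
      obtain ⟨u, rfl⟩ := exists_vecPoly_eq hq hr hQ hQd
      exact ⟨u, h.symm⟩
    · rintro ⟨u, rfl⟩
      have hl : IsLinearized 𝐪 r ((vecPoly 𝐪 r u).comp D) := (isLinearized_vecPoly u).comp Fq hD
      obtain ⟨c, hc⟩ := exists_vecPoly_eq hq hr hl ((hlt _).2 (degree_vecPoly_lt hq hr u))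
      refine ⟨c, mem_multiples.2 ?_, hc⟩
      rw [vecPolyLin_apply, hc]
      refine ⟨hl, ?_⟩
      rintro _ rfl
      exact dvd_comp_of_isLinearized hq (isLinearized_vecPoly u) _
  rw [(Submodule.equivMapOfInjective _ (hinj n) _).finrank_eq, hrange,
    LinearMap.finrank_range_of_inj ((comp_left_injective hpos).comp (hinj d)),
    Module.finrank_fin_fun]
  omega

/-- The rank length of a skew cyclic code in terms of the greatest common divisor of the conjugates
of its generator polynomial. -/
theorem rankLength_eq_sub_qDeg_gcd [Finite K] (hr : 0 < r) (hn : 0 < n) {m : ℕ} (hm : 0 < m)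
    (hK : Module.finrank Fq K = m) {C : Submodule K (Fin n → K)} (hC : IsSkewCyclic 𝐪 r C)
    {G D : K[X]} (hG : IsGeneratorPoly 𝐪 r C G)
    (hD : IsRightGcd 𝐪 r (fun i : Fin m => frobPoly 𝐪 i G) D) (hDn : qDeg 𝐪 r D ≤ n) :
    rankLength Fq C = n - qDeg 𝐪 r D := by
  have hdvd : ∀ i : Fin m, D ∣ frobPoly 𝐪 i G := fun i => (rightDvd_iff_dvd Fq hr hD.isLinearized
    (isLinearized_frobPoly Fq hG.isLinearized i)).1 (hD.dvd i)
  rw [← finrank_comap_multiples hr hD.isLinearized hD.monic hDn]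
  refine rankLength_eq_finrank Fq ?_ ?_ ?_
  · intro c hc
    obtain ⟨hl, hDc⟩ := mem_multiples.1 hc
    refine mem_multiples.2 ⟨isLinearized_vecPoly _, ?_⟩
    rintro _ rfl
    rw [vecPolyLin_apply, ← frobPoly_vecPoly, ← frobPoly_one_gcd hr hm hK hG.isLinearized hD]
    exact frobPoly_dvd Fq (hDc _ rfl) 1
  · intro c hc
    refine mem_multiples.2 ⟨isLinearized_vecPoly _, ?_⟩
    rintro _ rfl
    have := hdvd ⟨0, hm⟩
    rw [frobPoly_zero] at this
    exact this.trans (hG.dvd Fq hr hn hC (vecPoly_mem_codeIdeal hc))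
  -- Minimality: the Galois closure of `C` is cyclic with a generator `D₀`. Its ideal contains every
  -- conjugate of `G`, so `D₀` is a common divisor and divides `D`; hence every multiple of `D` lies
  -- in the closure.
  · intro V hV hCV c hc
    obtain ⟨hl, hDc⟩ := mem_multiples.1 hc
    refine galoisClosure_le hV hCV ?_
    obtain ⟨D₀, hD₀, -, hmin, hmem⟩ :=
      exists_codeIdeal_generator Fq hr hn (isSkewCyclic_galoisClosure Fq hC)
    have hD₀l := isLinearized_of_mem_codeIdeal Fq hD₀
    refine mem_of_vecPoly_mem_codeIdeal Fintype.one_lt_card hr hn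
      (hmem _ (isLinearized_vecPoly c) (Dvd.dvd.trans ?_ (hDc D rfl)))
    refine (rightDvd_iff_dvd Fq hr hD₀l hD.isLinearized).1 (hD.greatest _ hD₀l fun i => ?_)
    refine (rightDvd_iff_dvd Fq hr hD₀l (isLinearized_frobPoly Fq hG.isLinearized i)).2 (hmin _ ?_)
    exact frobPoly_mem_codeIdeal Fq (isGaloisClosed_galoisClosure _ _) (le_galoisClosure _ _)
      hG.mem i

end GaloisClosure


/-! ### Zero spaces in `L` and trace duality. -/

section Roots

/-- As many distinct zeroes in `L` as the degree force `F` to split over `L` with simple roots.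
Divisibility can then be tested on zeroes, and it descends from `L[X]` to `K[X]`. -/
theorem dvd_of_card_roots {K L : Type*} [Field K] [Field L] [Algebra K L] {F : K[X]}
    (hF : F ≠ 0) (hcard : Nat.card {z : L // aeval z F = 0} = F.natDegree) {B : K[X]}
    (hB : ∀ z : L, aeval z F = 0 → aeval z B = 0) : F ∣ B := by
  classical
  by_cases hB0 : B = 0
  · rw [hB0]
    exact dvd_zero F
  rw [← map_dvd_map' (algebraMap K L)]
  set f := F.map (algebraMap K L) with hf
  have hf0 : f ≠ 0 := (Polynomial.map_ne_zero_iff (algebraMap K L).injective).2 hF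
  have hroot : ∀ z, z ∈ f.roots ↔ aeval z F = 0 := fun z => by
    rw [mem_roots hf0, IsRoot.def, hf, eval_map_algebraMap]
  have hcard' : f.roots.toFinset.card = f.natDegree := by
    rw [hf, natDegree_map, ← hcard, ← hf]
    exact (Nat.subtype_card _ fun z => by rw [Multiset.mem_toFinset, hroot]).symm
  have hle : f.roots.toFinset.card ≤ f.roots.card := Multiset.toFinset_card_le _
  have heq : f.roots.card = f.natDegree := le_antisymm (card_roots' f) (hcard' ▸ hle)
  have hnodup : f.roots.Nodup :=
    Multiset.toFinset_card_eq_card_iff_nodup.1 (hcard'.trans heq.symm)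
  rw [← C_leadingCoeff_mul_prod_multiset_X_sub_C heq]
  refine (C_mul_dvd (leadingCoeff_ne_zero.2 hf0)).2 ?_
  have hb0 : B.map (algebraMap K L) ≠ 0 :=
    (Polynomial.map_ne_zero_iff (algebraMap K L).injective).2 hB0
  rw [Multiset.prod_X_sub_C_dvd_iff_le_roots hb0, Multiset.le_iff_subset hnodup]
  intro z hz
  rw [mem_roots hb0, IsRoot.def, eval_map_algebraMap]
  exact hB z ((hroot z).1 hz)

/-- `X^{|L|} - X` splits over `L` with simple roots, and its divisors inherit both properties. -/
theorem card_roots_of_dvd_X_pow_card_sub_X {K L : Type*} [Field K] [Field L] [Fintype L]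
    [Algebra K L] {F : K[X]} (hF : F ∣ X ^ Fintype.card L - X) :
    Nat.card {z : L // aeval z F = 0} = F.natDegree := by
  classical
  set f := F.map (algebraMap K L) with hf
  have hX0 : (X ^ Fintype.card L - X : L[X]) ≠ 0 :=
    FiniteField.X_pow_card_sub_X_ne_zero L Fintype.one_lt_card
  have hdvd : f ∣ X ^ Fintype.card L - X := by
    have := Polynomial.map_dvd (algebraMap K L) hF
    simpa using this
  have hf0 : f ≠ 0 := ne_zero_of_dvd_ne_zero hX0 hdvd
  have hnodup : f.roots.Nodup := by
    refine Multiset.nodup_of_le (roots.le_of_dvd hX0 hdvd) ?_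
    rw [FiniteField.roots_X_pow_card_sub_X]
    exact Finset.univ.nodup
  have hsplit : f.Splits := by
    refine Splits.of_dvd (splits_iff_card_roots.2 ?_) hX0 hdvd
    rw [FiniteField.roots_X_pow_card_sub_X,
      FiniteField.X_pow_card_sub_X_natDegree_eq L Fintype.one_lt_card]
    rfl
  rw [← natDegree_map (algebraMap K L), ← hf, hsplit.natDegree_eq_card_roots,
    ← Multiset.toFinset_card_of_nodup hnodup]
  refine Nat.subtype_card _ fun z => ?_
  rw [Multiset.mem_toFinset, mem_roots hf0, IsRoot.def, hf, eval_map_algebraMap]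

variable {K E L : Type*} [Field K] [Field E] [Fintype E] [Field L] [Algebra K L] [Algebra E L]
  {q r n : ℕ}

/-- Otherwise `X^2` would divide `x^{[rn]} - x`, whose coefficient at `x` is `-1`. This makes the
denominator `H_0^{[kr]}` in `perp` nonzero. -/
theorem coeff_one_ne_zero_of_dvd_modulus (hq : 1 < q) (hr : 0 < r) (hn : 0 < n) {F : K[X]}
    (hF : IsLinearized q r F) (hdvd : F ∣ modulus K q r n) : F.coeff 1 ≠ 0 := by
  intro h
  have hX : X ^ 2 ∣ F := by
    refine X_pow_dvd_iff.2 fun d hd => ?_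
    interval_cases d
    · exact hF.coeff_zero hq
    · exact h
  have h1 := X_pow_dvd_iff.1 (hX.trans hdvd) 1 (by norm_num)
  have h2 : 1 ≠ q ^ (r * n) := (Nat.one_lt_pow (by positivity) hq).ne
  simp [modulus, coeff_X_pow, h2] at h1

theorem perp_monic_and_natDegree (hq : 1 < q) (hr : 0 < r) {H : K[X]} (h1 : H.coeff 1 ≠ 0) :
    (perp q r H).Monic ∧ (perp q r H).natDegree = q ^ (r * qDeg q r H) := by
  have hlt : (∑ i ∈ Finset.range (qDeg q r H),
      C (H.coeff (q ^ (r * (qDeg q r H - i))) ^ q ^ (i * r) /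
        H.coeff (q ^ (r * 0)) ^ q ^ (qDeg q r H * r)) * X ^ q ^ (r * i)).degree <
      ((q ^ (r * qDeg q r H) : ℕ) : WithBot ℕ) := by
    refine (degree_sum_le _ _).trans_lt
      ((Finset.sup_lt_iff (WithBot.bot_lt_coe _)).2 fun i hi => ?_)
    refine (degree_C_mul_X_pow_le _ _).trans_lt ?_
    exact_mod_cast (q_pow_mul_lt_iff hq hr).2 (Finset.mem_range.1 hi)
  have heq : perp q r H = X ^ q ^ (r * qDeg q r H) + ∑ i ∈ Finset.range (qDeg q r H),
      C (H.coeff (q ^ (r * (qDeg q r H - i))) ^ q ^ (i * r) /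
        H.coeff (q ^ (r * 0)) ^ q ^ (qDeg q r H * r)) * X ^ q ^ (r * i) := by
    rw [perp, Finset.sum_range_succ, Nat.sub_self, div_self (pow_ne_zero _ (by simpa using h1)),
      C_1, one_mul, add_comm]
  rw [heq]
  refine ⟨monic_X_pow_add hlt, ?_⟩
  rw [natDegree_eq_of_degree_eq (degree_add_eq_left_of_degree_lt (by rwa [degree_X_pow])),
    natDegree_X_pow]

theorem exists_linearMap_aeval (hE : Fintype.card E = q ^ r) {F : K[X]}
    (hF : IsLinearized q r F) : ∃ φ : L →ₗ[E] L, ∀ z, φ z = aeval z F := by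
  refine hF.induction (P := fun F => ∃ φ : L →ₗ[E] L, ∀ z, φ z = aeval z F) ⟨0, by simp⟩ ?_ ?_
  · rintro A B ⟨φ, hφ⟩ ⟨ψ, hψ⟩
    exact ⟨φ + ψ, fun z => by simp [hφ, hψ]⟩
  · intro a i
    refine ⟨LinearMap.mulLeft E (algebraMap K L a) ∘ₗ (powHom E L i).toLinearMap, fun z => ?_⟩
    simp [powHom_apply, hE, pow_mul]

variable [Fintype L]

theorem card_roots_eq (hE : Fintype.card E = q ^ r) {F : K[X]} (hF : IsLinearized q r F) :
    Nat.card {z : L // aeval z F = 0} = q ^ (r * Module.finrank E (rootSpace E L F)) := by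
  rw [pow_mul, ← hE, ← Nat.card_eq_fintype_card, ← Module.natCard_eq_pow_finrank]
  exact Nat.card_congr (Equiv.subtypeEquivRight fun z => (mem_rootSpace hE hF z).symm)

theorem finrank_rootSpace (hE : Fintype.card E = q ^ r) (hL : Fintype.card L = q ^ (r * n))
    (hq : 1 < q) (hr : 0 < r) {F : K[X]} (hF : IsLinearized q r F) (hF0 : F ≠ 0)
    (hdvd : F ∣ modulus K q r n) : Module.finrank E (rootSpace E L F) = qDeg q r F := by
  rw [modulus, ← hL] at hdvd
  apply q_pow_mul_injective hq hr
  dsimp only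
  rw [← card_roots_eq hE hF, card_roots_of_dvd_X_pow_card_sub_X hdvd, hF.natDegree_eq hq hr hF0]

theorem dvd_of_finrank_rootSpace (hE : Fintype.card E = q ^ r) (hq : 1 < q) (hr : 0 < r) {F : K[X]}
    (hF : IsLinearized q r F) (hF0 : F ≠ 0)
    (h : Module.finrank E (rootSpace E L F) = qDeg q r F) {B : K[X]}
    (hB : ∀ z : L, aeval z F = 0 → aeval z B = 0) : F ∣ B := by
  refine dvd_of_card_roots hF0 ?_ hB
  rw [card_roots_eq hE hF, h, hF.natDegree_eq hq hr hF0]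

theorem aeval_modulus (hL : Fintype.card L = q ^ (r * n)) (z : L) :
    aeval z (modulus K q r n) = 0 := by
  rw [modulus, ← hL, map_sub, map_pow, aeval_X, FiniteField.pow_card, sub_self]

theorem trace_pow_card_pow (hE : Fintype.card E = q ^ r) (i : ℕ) (z : L) :
    Algebra.trace E L (z ^ q ^ (r * i)) = Algebra.trace E L z := by
  have hbij : Function.Bijective (powHom E L i) :=
    Finite.injective_iff_bijective.1 (powHom E L i : L →+* L).injective
  rw [pow_mul, ← hE, ← powHom_apply]
  exact Algebra.trace_eq_of_algEquiv (AlgEquiv.ofBijective _ hbij) z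

/-- The adjoint of evaluating `H` is, up to a scalar and a Frobenius twist, evaluation of `H^⊥`.
With `k = deg H`, raising the term `H_i z^{[ri]} y` to the power `[r(k-i)]` does not change its
trace and turns the factor in `z` into the common `z^{[rk]}`. -/
theorem trace_aeval_mul (hE : Fintype.card E = q ^ r) (hq : 1 < q) (hr : 0 < r) {H : K[X]}
    (hH : IsLinearized q r H) (h1 : H.coeff 1 ≠ 0) (y z : L) :
    Algebra.trace E L (aeval z H * y) = Algebra.trace E L (aeval y (perp q r H) *
      (algebraMap K L (H.coeff 1) ^ q ^ (qDeg q r H * r) * z ^ q ^ (r * qDeg q r H))) := by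
  have h1' : algebraMap K L (H.coeff 1) ≠ 0 := by simpa using h1
  have hleft : aeval z H = ∑ i ∈ Finset.range (qDeg q r H + 1),
      algebraMap K L (H.coeff (q ^ (r * i))) * z ^ q ^ (r * i) := by
    conv_lhs => rw [hH.eq_sum hq hr (Nat.lt_succ_self _)]
    simp
  have hright : aeval y (perp q r H) *
      (algebraMap K L (H.coeff 1) ^ q ^ (qDeg q r H * r) * z ^ q ^ (r * qDeg q r H)) =
      ∑ i ∈ Finset.range (qDeg q r H + 1),
        (algebraMap K L (H.coeff (q ^ (r * i))) * z ^ q ^ (r * i) * y) ^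
          q ^ (r * (qDeg q r H - i)) := by
    rw [← Finset.sum_range_reflect, perp, map_sum, Finset.sum_mul]
    refine Finset.sum_congr rfl fun i hi => ?_
    have hi' : i ≤ qDeg q r H := Nat.lt_succ_iff.1 (Finset.mem_range.1 hi)
    have e1 : qDeg q r H + 1 - 1 - i = qDeg q r H - i := by omega
    rw [e1, Nat.sub_sub_self hi', mul_pow, mul_pow, ← pow_mul z, ← pow_add, ← mul_add,
      Nat.sub_add_cancel hi', map_mul, aeval_C, map_pow, aeval_X, map_div₀, map_pow, map_pow,
      mul_zero, pow_zero, mul_comm i r]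
    field_simp
  rw [hright, hleft, Finset.sum_mul, map_sum, map_sum]
  exact Finset.sum_congr rfl fun i _ => (trace_pow_card_pow hE _ _).symm

variable {Fq : Type*} [Field Fq] [Fintype Fq]

local notation "𝐪" => Fintype.card Fq

/-- The zeroes of `H^⊥` are the orthogonal complement, for the trace form, of the zeroes of `G`. -/
theorem rootSpace_perp [Algebra Fq K] [Algebra Fq L] (hE : Fintype.card E = 𝐪 ^ r)
    (hL : Fintype.card L = 𝐪 ^ (r * n)) (hEL : Module.finrank E L = n) (hr : 0 < r) (hn : 0 < n)
    {G H : K[X]} (hG : IsLinearized 𝐪 r G) (hGH : IsCheckPoly 𝐪 r n G H) :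
    rootSpace E L (perp 𝐪 r H) = (Algebra.traceForm E L).orthogonal (rootSpace E L G) := by
  have hq : 1 < 𝐪 := Fintype.one_lt_card
  have hH := hGH.isLinearized
  have hmod : modulus K 𝐪 r n ≠ 0 := modulus_ne_zero hq hr hn
  have hGd : G ∣ modulus K 𝐪 r n := hGH.check_comp_gen ▸ dvd_comp_of_isLinearized hq hH G
  have hHd : H ∣ modulus K 𝐪 r n := hGH.gen_comp_check ▸ dvd_comp_of_isLinearized hq hG H
  have hG0 := ne_zero_of_dvd_ne_zero hmod hGd
  have hH0 := ne_zero_of_dvd_ne_zero hmod hHd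
  have h1 := coeff_one_ne_zero_of_dvd_modulus hq hr hn hH hHd
  have hdeg : qDeg 𝐪 r G + qDeg 𝐪 r H = n := by
    rw [← qDeg_comp hr hG hH hG0 hH0, hGH.gen_comp_check]
    exact (isLinearized_modulus n).qDeg_eq_of_natDegree hq hr (natDegree_modulus hq hr hn)
  obtain ⟨φ, hφ⟩ := exists_linearMap_aeval (L := L) hE hH
  have hker : LinearMap.ker φ = rootSpace E L H := by
    ext z
    rw [LinearMap.mem_ker, hφ, mem_rootSpace hE hH]
  -- Since `G ∘ H` vanishes on `L`, the image of `H` lies in `Z(G)`; rank-nullity gives it dimension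
  -- `n - deg H = deg G`, so they agree.
  have hrange : LinearMap.range φ = rootSpace E L G := by
    apply Submodule.eq_of_le_of_finrank_eq
    · rintro _ ⟨z, rfl⟩
      rw [mem_rootSpace hE hG, hφ, ← aeval_comp, hGH.gen_comp_check, aeval_modulus hL]
    · have := LinearMap.finrank_range_add_finrank_ker φ
      rw [hker, finrank_rootSpace hE hL hq hr hH hH0 hHd, hEL] at this
      rw [finrank_rootSpace hE hL hq hr hG hG0 hGd]
      omega
  have hfrob : Function.Surjective fun z : L => z ^ 𝐪 ^ (r * qDeg 𝐪 r H) := by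
    have := Finite.surjective_of_injective (powHom Fq L (r * qDeg 𝐪 r H) : L →+* L).injective
    intro y
    obtain ⟨z, hz⟩ := this y
    exact ⟨z, by rw [← hz, RingHom.coe_coe, powHom_apply]⟩
  ext y
  rw [mem_rootSpace hE (isLinearized_perp H), LinearMap.BilinForm.mem_orthogonal_iff, ← hrange]
  constructor
  · rintro hy _ ⟨z, rfl⟩
    rw [Algebra.traceForm_apply, hφ, trace_aeval_mul hE hq hr hH h1,
      hy, zero_mul, map_zero]
  · intro h
    have hc : algebraMap K L (H.coeff 1) ^ 𝐪 ^ (qDeg 𝐪 r H * r) ≠ 0 :=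
      pow_ne_zero _ (by simpa using h1)
    -- The factor `H_0^{[kr]} z^{[rk]}` takes every value `w` in `L`, so nondegeneracy forces
    -- `H^⊥(y) = 0`.
    refine (traceForm_nondegenerate E L).1 _ fun w => ?_
    obtain ⟨z, hz⟩ := hfrob ((algebraMap K L (H.coeff 1) ^ 𝐪 ^ (qDeg 𝐪 r H * r))⁻¹ * w)
    have := h (φ z) ⟨z, rfl⟩
    dsimp only at hz
    rwa [Algebra.traceForm_apply, hφ,
      trace_aeval_mul hE hq hr hH h1, hz, mul_inv_cancel_left₀ hc] at this

/-- `θ_i(F)(w^{[i]}) = F(w)^{[i]}`, and the Frobenius map is bijective on `L`. -/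
theorem powSpace_rootSpace [Algebra Fq K] [Algebra Fq E] [Algebra Fq L] [IsScalarTower Fq E L]
    (hE : Fintype.card E = 𝐪 ^ r) {F : K[X]} (hF : IsLinearized 𝐪 r F) (i : ℕ) :
    powSpace 𝐪 i (rootSpace E L F) = rootSpace E L (frobPoly 𝐪 i F) := by
  have haeval : ∀ w : L, aeval (w ^ 𝐪 ^ i) (frobPoly 𝐪 i F) = aeval w F ^ 𝐪 ^ i := fun w => by
    rw [← powHom_apply (Fq := Fq), ← powHom_apply (Fq := Fq), frobPoly_eq_map, aeval_def,
      eval₂_map, aeval_def, ← RingHom.coe_coe, ← RingHom.coe_coe, hom_eval₂]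
    congr 1
    ext a
    simp [powHom_apply]
  ext z
  rw [mem_powSpace, mem_rootSpace hE (isLinearized_frobPoly Fq hF i)]
  constructor
  · rintro ⟨w, hw, rfl⟩
    rw [haeval, (mem_rootSpace hE hF w).1 hw, zero_pow (pow_pos Fintype.card_pos _).ne']
  · intro hz
    obtain ⟨w, rfl⟩ := Finite.surjective_of_injective (powHom Fq L i : L →+* L).injective z
    rw [RingHom.coe_coe, powHom_apply] at hz ⊢
    rw [haeval] at hz
    exact ⟨w, (mem_rootSpace hE hF w).2 (eq_zero_of_pow_eq_zero hz), rfl⟩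

end Roots


/-! ### Orthogonality exchanges sums and intersections. -/

section Duality

theorem orthogonal_iSup {E V ι : Type*} [Field E] [AddCommGroup V] [Module E V]
    (B : LinearMap.BilinForm E V) (U : ι → Submodule E V) :
    B.orthogonal (⨆ i, U i) = ⨅ i, B.orthogonal (U i) := by
  refine le_antisymm
    (le_iInf fun i => LinearMap.BilinForm.orthogonal_le (le_iSup U i)) fun v hv => ?_
  have hle : ⨆ i, U i ≤ LinearMap.ker (B.flip v) :=
    iSup_le fun i u hu => (Submodule.mem_iInf _).1 hv i u hu
  exact fun u hu => hle hu

theorem iSup_orthogonal {E V ι : Type*} [Field E] [AddCommGroup V] [Module E V]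
    [FiniteDimensional E V] {B : LinearMap.BilinForm E V} (hB : B.Nondegenerate)
    (hB' : B.IsRefl) (W : ι → Submodule E V) :
    ⨆ i, B.orthogonal (W i) = B.orthogonal (⨅ i, W i) := by
  rw [← LinearMap.BilinForm.orthogonal_orthogonal hB hB' (⨆ i, B.orthogonal (W i)),
    orthogonal_iSup]
  simp only [LinearMap.BilinForm.orthogonal_orthogonal hB hB']

end Duality

/-! ### Zero spaces of gcds and lcms, and existence of check polynomials. -/

section GcdLcm

variable {Fq K E L : Type*} [Field Fq] [Fintype Fq] [Field K] [Algebra Fq K] [Field L]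
  [Algebra K L] {r n : ℕ}

local notation "𝐪" => Fintype.card Fq

theorem rootSpace_gcd [Field E] [Fintype E] [Algebra E L] (hE : Fintype.card E = 𝐪 ^ r) (hr : 0 < r)
    {ι : Type*} [Nonempty ι] {F : ι → K[X]} (hF : ∀ i, IsLinearized 𝐪 r (F i)) (hF0 : ∀ i, F i ≠ 0)
    {D : K[X]} (hD : IsRightGcd 𝐪 r F D) : rootSpace E L D = ⨅ i, rootSpace E L (F i) := by
  ext z
  simp only [Submodule.mem_iInf, mem_rootSpace hE hD.isLinearized, mem_rootSpace hE (hF _)]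
  constructor
  · intro hz i
    exact aeval_eq_zero_of_dvd_aeval_eq_zero
      ((rightDvd_iff_dvd Fq hr hD.isLinearized (hF i)).1 (hD.dvd i)) hz
  · intro hz
    obtain ⟨i₀⟩ := ‹Nonempty ι›
    -- `A` is the least linearized multiple of the minimal polynomial of the common zero `z`. It
    -- divides every `F i`, hence divides `D`, and so `z` is a zero of `D`.
    obtain ⟨A, hA, -, hdvd, hmin⟩ := exists_monic_generator_multiples Fq hr {minpoly K z} (hF i₀)
      (hF0 i₀) (by rintro _ rfl; exact minpoly.dvd K z (hz i₀))
    have hAD : A ∣ D := by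
      refine (rightDvd_iff_dvd Fq hr hA hD.isLinearized).1 (hD.greatest A hA fun i => ?_)
      refine (rightDvd_iff_dvd Fq hr hA (hF i)).2 (hmin _ (hF i) ?_)
      rintro _ rfl
      exact minpoly.dvd K z (hz i)
    exact aeval_eq_zero_of_dvd_aeval_eq_zero ((hdvd _ rfl).trans hAD) (minpoly.aeval K z)

variable [Fintype L]

/-- The modulus is central because `K` embeds in `L`, so the power `[rn]` fixes all coefficients. -/
theorem comp_modulus (hL : Fintype.card L = 𝐪 ^ (r * n)) {F : K[X]} (hF : IsLinearized 𝐪 r F) :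
    F.comp (modulus K 𝐪 r n) = (modulus K 𝐪 r n).comp F := by
  have hpow : ∀ a : K, a ^ 𝐪 ^ (r * n) = a := fun a => by
    apply (algebraMap K L).injective
    rw [map_pow, ← hL, FiniteField.pow_card]
  refine hF.induction (P := fun F => F.comp (modulus K 𝐪 r n) = (modulus K 𝐪 r n).comp F) ?_ ?_ ?_
  · simp [modulus]
  · intro A B hA hB
    rw [add_comp, hA, hB]
    simp only [modulus, sub_comp, pow_comp, X_comp, add_pow_card_pow]
    ring
  · intro a i
    simp only [modulus, mul_comp, C_comp, sub_comp, pow_comp, X_comp, sub_pow_card_pow, mul_pow,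
      ← C_pow, hpow]
    ring

/-- Right divisibility gives only `H ∘ D = x^{[rn]} - x`. Centrality of the modulus yields `(D ∘ H)
∘ D = (x^{[rn]} - x) ∘ D`, and cancelling `D` on the right gives the other order. -/
theorem exists_isCheckPoly (hL : Fintype.card L = 𝐪 ^ (r * n)) (hr : 0 < r) (hn : 0 < n) {D : K[X]}
    (hD : IsLinearized 𝐪 r D) (hdvd : D ∣ modulus K 𝐪 r n) : ∃ H, IsCheckPoly 𝐪 r n D H := by
  have hq : 1 < 𝐪 := Fintype.one_lt_card
  have hD0 : D ≠ 0 := ne_zero_of_dvd_ne_zero (modulus_ne_zero hq hr hn) hdvd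
  obtain ⟨H, hH, h⟩ := (rightDvd_iff_dvd Fq hr hD (isLinearized_modulus n)).2 hdvd
  refine ⟨H, hH, comp_left_injective (hD.natDegree_pos hq hD0) ?_, h.symm⟩
  rw [← comp_eq_aeval, ← comp_eq_aeval, comp_assoc, ← h, comp_modulus hL hD]

theorem IsCheckPoly.frobPoly {G H : K[X]} (h : IsCheckPoly 𝐪 r n G H) (i : ℕ) :
    IsCheckPoly 𝐪 r n (frobPoly 𝐪 i G) (frobPoly 𝐪 i H) where
  isLinearized := isLinearized_frobPoly Fq h.isLinearized i
  gen_comp_check := by rw [← frobPoly_comp, h.gen_comp_check, frobPoly_modulus]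
  check_comp_gen := by rw [← frobPoly_comp, h.check_comp_gen, frobPoly_modulus]

variable [Field E] [Fintype E] [Algebra E L]

/-- A linearized polynomial whose zeroes span the sum of the spaces of zeroes of a family is the
least common multiple of that family. -/
theorem isRightLcm_of_rootSpace (hE : Fintype.card E = 𝐪 ^ r) (hr : 0 < r) {ι : Type*}
    {F : ι → K[X]} (hF : ∀ i, IsLinearized 𝐪 r (F i)) (hF0 : ∀ i, F i ≠ 0)
    (hFr : ∀ i, Module.finrank E (rootSpace E L (F i)) = qDeg 𝐪 r (F i)) {M : K[X]}
    (hM : IsLinearized 𝐪 r M) (hMm : M.Monic)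
    (hMr : Module.finrank E (rootSpace E L M) = qDeg 𝐪 r M)
    (h : rootSpace E L M = ⨆ i, rootSpace E L (F i)) : IsRightLcm 𝐪 r F M := by
  have hq : 1 < 𝐪 := Fintype.one_lt_card
  refine ⟨hM, hMm, fun i => (rightDvd_iff_dvd Fq hr (hF i) hM).2 ?_, fun M' hM' hd =>
    (rightDvd_iff_dvd Fq hr hM hM').2 ?_⟩
  · refine dvd_of_finrank_rootSpace hE hq hr (hF i) (hF0 i) (hFr i) fun z hz => ?_
    rw [← mem_rootSpace hE hM, h]
    exact Submodule.mem_iSup_of_mem i ((mem_rootSpace hE (hF i) z).2 hz)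
  · refine dvd_of_finrank_rootSpace hE hq hr hM hMm.ne_zero hMr fun z hz => ?_
    rw [← mem_rootSpace hE hM, h] at hz
    have hle : ⨆ i, rootSpace E L (F i) ≤ rootSpace E L M' := iSup_le fun i z hz => by
      rw [mem_rootSpace hE (hF i)] at hz
      rw [mem_rootSpace hE hM']
      exact aeval_eq_zero_of_dvd_aeval_eq_zero
        ((rightDvd_iff_dvd Fq hr (hF i) hM').1 (hd i)) hz
    exact (mem_rootSpace hE hM' z).1 (hle hz)

/-- `H^⊥` is not first shown to divide the modulus: that it has all its zeroes in `L` follows from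
the dimension of the orthogonal of `Z(G)`, namely `n - deg G = deg H`. -/
theorem finrank_rootSpace_perp [Algebra Fq L] (hE : Fintype.card E = 𝐪 ^ r)
    (hL : Fintype.card L = 𝐪 ^ (r * n)) (hEL : Module.finrank E L = n) (hr : 0 < r) (hn : 0 < n)
    {G H : K[X]} (hG : IsLinearized 𝐪 r G) (hGH : IsCheckPoly 𝐪 r n G H) :
    (perp 𝐪 r H).Monic ∧ qDeg 𝐪 r (perp 𝐪 r H) = n - qDeg 𝐪 r G ∧
      Module.finrank E (rootSpace E L (perp 𝐪 r H)) = qDeg 𝐪 r (perp 𝐪 r H) := by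
  have hq : 1 < 𝐪 := Fintype.one_lt_card
  have hH := hGH.isLinearized
  have hmod : modulus K 𝐪 r n ≠ 0 := modulus_ne_zero hq hr hn
  have hGd : G ∣ modulus K 𝐪 r n := hGH.check_comp_gen ▸ dvd_comp_of_isLinearized hq hH G
  have hHd : H ∣ modulus K 𝐪 r n := hGH.gen_comp_check ▸ dvd_comp_of_isLinearized hq hG H
  have hG0 := ne_zero_of_dvd_ne_zero hmod hGd
  have hH0 := ne_zero_of_dvd_ne_zero hmod hHd
  have hdeg : qDeg 𝐪 r G + qDeg 𝐪 r H = n := by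
    rw [← qDeg_comp hr hG hH hG0 hH0, hGH.gen_comp_check]
    exact (isLinearized_modulus n).qDeg_eq_of_natDegree hq hr (natDegree_modulus hq hr hn)
  obtain ⟨hm, hd⟩ := perp_monic_and_natDegree hq hr (coeff_one_ne_zero_of_dvd_modulus hq hr hn hH hHd)
  have hd' := (isLinearized_perp H).qDeg_eq_of_natDegree hq hr hd
  refine ⟨hm, by omega, ?_⟩
  rw [rootSpace_perp hE hL hEL hr hn hG hGH,
    LinearMap.BilinForm.finrank_orthogonal (traceForm_nondegenerate E L),
    finrank_rootSpace hE hL hq hr hG hG0 hGd, hd', hEL]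
  omega

end GcdLcm

end SkewCyclic

/-! ### The main theorem. -/

open SkewCyclic in
theorem mainTheorem4
    {Fq K E L : Type*} [Field Fq] [Field K] [Field E] [Field L] [Fintype Fq]
    [Algebra Fq K] [Algebra Fq E] [Algebra Fq L] [Algebra K L] [Algebra E L]
    [IsScalarTower Fq K L] [IsScalarTower Fq E L]
    (q m n r : ℕ) (hm : 0 < m) (hn : 0 < n) (hr : 0 < r) (hmrn : m ∣ r * n)
    (hq : Fintype.card Fq = q) (hK : Module.finrank Fq K = m)
    (hE : Module.finrank Fq E = r) (hL : Module.finrank Fq L = r * n)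
    (C : Submodule K (Fin n → K)) (hC : IsSkewCyclic q r C)
    (G H : Polynomial K) (hG : IsGeneratorPoly q r C G) (hH : IsCheckPoly q r n G H) :
    (∃! D : Polynomial K, IsRightGcd q r (fun i : Fin m => frobPoly q i G) D) ∧
    (∃! M : Polynomial K, IsRightLcm q r (fun i : Fin m => frobPoly q i (perp q r H)) M) ∧
    (∀ D : Polynomial K, IsRightGcd q r (fun i : Fin m => frobPoly q i G) D →
      (rankLength Fq C : ℤ) = (n : ℤ) - (qDeg q r D : ℤ)) ∧
    (∀ M : Polynomial K, IsRightLcm q r (fun i : Fin m => frobPoly q i (perp q r H)) M →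
      rankLength Fq C = qDeg q r M) ∧
    (rankLength Fq C : ℤ) = (n : ℤ) -
      (Module.finrank E
        (⨅ i : Fin m, powSpace q i (rootSpace E L G) : Submodule E L) : ℤ) ∧
    rankLength Fq C =
      Module.finrank E
        (⨆ i : Fin m, powSpace q i (rootSpace E L (perp q r H)) : Submodule E L) := by
  subst hq
  have hq : 1 < Fintype.card Fq := Fintype.one_lt_card
  have : FiniteDimensional Fq K := Module.finite_of_finrank_pos (by omega)
  have : FiniteDimensional Fq E := Module.finite_of_finrank_pos (by omega)
  have : FiniteDimensional Fq L := Module.finite_of_finrank_pos (by rw [hL]; positivity)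
  have : Finite K := Module.finite_of_finite Fq
  have : Finite E := Module.finite_of_finite Fq
  have : Finite L := Module.finite_of_finite Fq
  have := Fintype.ofFinite E
  have := Fintype.ofFinite L
  have : Nonempty (Fin m) := ⟨⟨0, hm⟩⟩
  have hEc : Fintype.card E = Fintype.card Fq ^ r := by
    rw [← hE]; exact Module.card_eq_pow_finrank
  have hLc : Fintype.card L = Fintype.card Fq ^ (r * n) := by
    rw [← hL]; exact Module.card_eq_pow_finrank
  have hEL : Module.finrank E L = n := by
    have := Module.finrank_mul_finrank Fq E L
    rw [hE, hL] at this
    exact Nat.eq_of_mul_eq_mul_left hr this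
  have hGi := fun i : Fin m => isLinearized_frobPoly Fq hG.isLinearized i
  have hGi0 := fun i : Fin m => (frobPoly_monic Fq hG.monic i).ne_zero
  obtain ⟨D, hD⟩ := exists_isRightGcd Fq hr (fun i : Fin m => frobPoly (Fintype.card Fq) i G) hGi
    ⟨⟨0, hm⟩, hGi0 _⟩
  -- `D` divides the conjugate of index `0`, which divides the modulus through its check polynomial.
  have hDmod : D ∣ modulus K (Fintype.card Fq) r n := by
    have h0 := (rightDvd_iff_dvd Fq hr hD.isLinearized (hGi ⟨0, hm⟩)).1 (hD.dvd ⟨0, hm⟩)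
    have h1 := (hH.frobPoly 0).check_comp_gen ▸
      dvd_comp_of_isLinearized hq (isLinearized_frobPoly Fq hH.isLinearized 0) (frobPoly _ 0 G)
    exact h0.trans h1
  have hDr : Module.finrank E (rootSpace E L D) = qDeg (Fintype.card Fq) r D :=
    finrank_rootSpace hEc hLc hq hr hD.isLinearized hD.monic.ne_zero hDmod
  have hDn : qDeg (Fintype.card Fq) r D ≤ n := by
    rw [← hDr, ← hEL]
    exact Submodule.finrank_le _
  have hlen := rankLength_eq_sub_qDeg_gcd hr hn hm hK hC hG hD hDn
  have hDroot : rootSpace E L D =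
      ⨅ i : Fin m, rootSpace E L (frobPoly (Fintype.card Fq) i G) :=
    rootSpace_gcd hEc hr hGi hGi0 hD
  -- The witness for the lcm is `HD^⊥`, with `HD` the check polynomial of the gcd.
  obtain ⟨HD, hHD⟩ := exists_isCheckPoly hLc hr hn hD.isLinearized hDmod
  obtain ⟨hMm, hMd, hMr⟩ :=
    finrank_rootSpace_perp hEc hLc hEL hr hn hD.isLinearized hHD
  have hPi := fun i : Fin m =>
    finrank_rootSpace_perp hEc hLc hEL hr hn (hGi i) (hH.frobPoly (i : ℕ))
  -- `Z(HD^⊥) = Z(D)^⊥ = (⋂ Z(θ_i G))^⊥ = ∑ Z(θ_i G)^⊥`, and each summand is `Z((θ_i H)^⊥) =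
  -- Z(θ_i(H^⊥))`.
  have hMroot : rootSpace E L (perp (Fintype.card Fq) r HD) = ⨆ i : Fin m,
      rootSpace E L (frobPoly (Fintype.card Fq) i (perp (Fintype.card Fq) r H)) := by
    rw [rootSpace_perp hEc hLc hEL hr hn hD.isLinearized hHD, hDroot,
      ← iSup_orthogonal (traceForm_nondegenerate E L) (Algebra.traceForm_isSymm E).isRefl]
    refine iSup_congr fun i => ?_
    rw [frobPoly_perp, rootSpace_perp hEc hLc hEL hr hn (hGi i) (hH.frobPoly (i : ℕ))]
  have hM : IsRightLcm (Fintype.card Fq) r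
      (fun i : Fin m => frobPoly (Fintype.card Fq) i (perp (Fintype.card Fq) r H))
      (perp (Fintype.card Fq) r HD) := by
    refine isRightLcm_of_rootSpace hEc hr
      (fun i : Fin m => isLinearized_frobPoly Fq (isLinearized_perp H) i) (fun i => ?_) (fun i => ?_)
      (isLinearized_perp HD) hMm hMr hMroot
    · rw [frobPoly_perp]
      exact (hPi i).1.ne_zero
    · rw [frobPoly_perp]
      exact (hPi i).2.2
  refine ⟨⟨D, hD, fun D' hD' => hD'.eq Fq hD hr⟩, ⟨_, hM, fun M' hM' => hM'.eq Fq hM hr⟩,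
    fun D' hD' => ?_, fun M' hM' => ?_, ?_, ?_⟩
  · rw [hD'.eq Fq hD hr, hlen]
    -- The natural-number subtraction in `hlen` agrees with the integer one thanks to `hDn`.
    omega
  · rw [hM'.eq Fq hM hr, hlen, hMd]
  · rw [iInf_congr fun i : Fin m => powSpace_rootSpace hEc hG.isLinearized (i : ℕ), ← hDroot, hDr, hlen]
    omega
  · rw [iSup_congr fun i : Fin m => powSpace_rootSpace hEc (isLinearized_perp H) (i : ℕ), ← hMroot, hMr, hlen, hMd]
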